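/- **Conventions.** $C_b(\mathbb R)$ is the space of bounded continuous functions on $\mathbb R$ with the supremum norm, $\mathcal M_+(\mathbb R)$ the set of finite positive Radon measures on $\mathbb R$ with the topology of weak convergence (against bounded continuous functions), and subscripts $x,t$ denote weak derivatives of $\bar u$ and $u$, classical derivatives of test functions. Let $\mathcal D$ be the set of pairs $(\bar u,\bar\mu)$ with $\bar u\in C_b(\mathbb R)$, $\bar u_x\in L^2(\mathbb R)$, $\bar\mu\in\mathcal M_+(\mathbb R)$ and $d\bar\mu_{ac}=\bar u_x^2\,dx$, where $\bar\mu_{ac}$ is the absolutely continuous part of $\bar\mu$ with respect to Lebesgue measure. For $(\bar u,\bar\mu)\in\mathcal D$, a pair $(u,\mu)$ is a (global-in-time) *conservative solution* with initial datum $(\bar u,\bar\mu)$ if 1. $u\in C(\mathbb R;C_b(\mathbb R))\cap C^{1/2}_{loc}(\mathbb R\times\mathbb R)$, $u_t\in L^2_{loc}(\mathbb R\times\mathbb R)$, $u_x(\cdot,t)\in L^2(\mathbb R)$ for all $t\in\mathbb R$, and $\mu\in C(\mathbb R;\mathcal M_+(\mathbb R))$; 2. $(u(\cdot,0),\mu(0))=(\bar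 u,\bar\mu)$, and $d\mu(t)=u_x^2(x,t)\,dx$ for a.e. $t\in\mathbb R$; 3. for all $\phi\in C_c^\infty(\mathbb R\times\mathbb R)$, with $F(x,t)=\mu(t)((-\infty,x])$, $$\int_{\mathbb R}\int_{\mathbb R}\Big(u\phi_t-\phi\big(uu_x-\tfrac12F\big)\Big)\,dx\,dt=0;$$ 4. for all $\phi\in C_c^\infty(\mathbb R\times\mathbb R)$, $\displaystyle\int_{\mathbb R}\int_{\mathbb R}(\phi_t+u\phi_x)\,d\mu(t)\,dt=0$; 5. $d\mu_{ac}(t)=u_x^2(x,t)\,dx$ for all $t\in\mathbb R$. For $\alpha\in\mathbb R$ let $\bar x(\alpha)$ be the unique real number with $$\bar x(\alpha)+\bar\mu((-\infty,\bar x(\alpha)))\le\alpha\le\bar x(\alpha)+\bar\mu((-\infty,\bar x(\alpha)]),$$ and set $f(\alpha)=1-\bar x'(\alpha)$ (defined for a.e. $\alpha$) and $$y(\alpha,t)=\bar x(\alpha)+\bar u(\bar x(\alpha))\,t+\frac{t^2}{4}(\alpha-\bar x(\alpha)).$$ **Theorem 3.2** (Uniqueness of characteristics and conservative solutions). Let $(\bar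 u,\bar\mu)\in\mathcal D$ and let $(v,\nu)$ be any conservative solution with initial datum $(\bar u,\bar\mu)$. Then for every $\alpha\in\mathbb R$ there is a unique characteristic $t\mapsto y_1(\alpha,t)$ on $\mathbb R$ satisfying $$\partial_t y_1(\alpha,t)=v(y_1(\alpha,t),t)\quad (t\in\mathbb R),\qquad y_1(\alpha,0)=\bar x(\alpha),$$ and $$\nu(t)((-\infty,y_1(\alpha,t)))\le\alpha-\bar x(\alpha)\le\nu(t)((-\infty,y_1(\alpha,t)])\qquad\text{for a.e. }t\in\mathbb R.$$ This characteristic is $y_1(\alpha,t)=y(\alpha,t)$. Moreover, for every $t\in\mathbb R$ the map $y(\cdot,t)$ is onto $\mathbb R$, and $(v,\nu)=(u,\mu)$, where $u$ and $\mu$ are given by $$u(x,t)=\partial_ty(\alpha,t)=\bar u(\bar x(\alpha))+\frac t2(\alpha-\bar x(\alpha))\ \text{ whenever } x=y(\alpha,t),\qquad \mu(t)=y(\cdot,t)\#(f\,d\alpha)\ \text{ for all } t\in\mathbb R.$$ -/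

import Mathlib

open MeasureTheory Set Filter Topology
open scoped NNReal ENNReal ContDiff BoundedContinuousFunction

noncomputable section

namespace HunterSaxton

/-! ### Weak derivatives and test functions

Points of the plane are written `p = (x, t)`, space first and time second. -/

/-- `g` is the weak (distributional) derivative of `f : ℝ → ℝ`. -/
structure IsWeakDeriv (f g : ℝ → ℝ) : Prop where
  locallyIntegrable : LocallyIntegrable f
  locallyIntegrable_deriv : LocallyIntegrable g
  integral_eq : ∀ φ : ℝ → ℝ, ContDiff ℝ ∞ φ → HasCompactSupport φ →
    ∫ x, f x * deriv φ x = -∫ x, g x * φ x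

/-- Test functions in `C_c^∞(ℝ × ℝ)`. -/
structure IsTestFunction (φ : ℝ × ℝ → ℝ) : Prop where
  smooth : ContDiff ℝ ∞ φ
  compactSupport : HasCompactSupport φ

/-- The partial derivative `φ_x (x, t)`. -/
def dx (φ : ℝ × ℝ → ℝ) (x t : ℝ) : ℝ := deriv (fun z => φ (z, t)) x

/-- The partial derivative `φ_t (x, t)`. -/
def dt (φ : ℝ × ℝ → ℝ) (x t : ℝ) : ℝ := deriv (fun s => φ (x, s)) t

/-! ### The set of states and conservative solutions

A bounded continuous function is an element of `ℝ →ᵇ ℝ` (with the supremum norm), and a finite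
positive Radon measure on the line is an element of `FiniteMeasure ℝ` (with the topology of weak
convergence of measures).  A time dependent state is given by `u : ℝ → (ℝ →ᵇ ℝ)` and
`μ : ℝ → FiniteMeasure ℝ`, so that `u t x` stands for `u (x, t)`. -/

/-- `dμ_ac = w ^ 2 dx`: the absolutely continuous part of `μ` in its Lebesgue decomposition has
density `w ^ 2`. -/
def AcPartEqSq (μ : Measure ℝ) (w : ℝ → ℝ) : Prop :=
  volume.withDensity (μ.rnDeriv volume) = volume.withDensity (fun x => ENNReal.ofReal (w x ^ 2))

/-- The set `𝒟` of pairs `(u, μ)` with `u ∈ C_b(ℝ)`, `u_x ∈ L²(ℝ)`, `μ` a finite positive Radon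
measure and `dμ_ac = u_x² dx`. -/
def MemD (u : ℝ →ᵇ ℝ) (μ : FiniteMeasure ℝ) : Prop :=
  ∃ ux : ℝ → ℝ, IsWeakDeriv u ux ∧ MemLp ux 2 volume ∧ AcPartEqSq (μ : Measure ℝ) ux

/-- `(u, μ)` is a global-in-time conservative solution of
`u_t + u u_x = (1/2) ∫_{-∞}^x dμ(t)`, `μ_t + (u μ)_x = 0`, `dμ_ac(t) = u_x² dx`
with initial datum `(u₀, μ₀)`. -/
structure IsConservativeSolution (u₀ : ℝ →ᵇ ℝ) (μ₀ : FiniteMeasure ℝ)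
    (u : ℝ → (ℝ →ᵇ ℝ)) (μ : ℝ → FiniteMeasure ℝ) : Prop where
  /-- `u ∈ C(ℝ; C_b(ℝ))`. -/
  continuous_u : Continuous u
  /-- `u ∈ C^{1/2}_loc(ℝ × ℝ)`. -/
  locallyHolder : ∀ K : Set (ℝ × ℝ), IsCompact K →
    ∃ C : ℝ≥0, HolderOnWith C (1 / 2) (fun p : ℝ × ℝ => u p.2 p.1) K
  /-- The weak time derivative `u_t` exists and lies in `L²_loc(ℝ × ℝ)`. -/
  exists_ut : ∃ ut : ℝ × ℝ → ℝ,
    (∀ K : Set (ℝ × ℝ), IsCompact K → MemLp ut 2 (volume.restrict K)) ∧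
    ∀ φ : ℝ × ℝ → ℝ, IsTestFunction φ →
      ∫ p : ℝ × ℝ, u p.2 p.1 * dt φ p.1 p.2 = -∫ p : ℝ × ℝ, ut p * φ p
  /-- `μ ∈ C(ℝ; ℳ₊(ℝ))`. -/
  continuous_μ : Continuous μ
  initial_u : u 0 = u₀
  initial_μ : μ 0 = μ₀
  /-- All conditions that involve the weak space derivative `u_x` (`ux t x` is `u_x (x, t)`).  They
  do not depend on the chosen representatives of `u_x (·, t)`: `u_x (·, t) ∈ L²(ℝ)` for all `t`,
  `dμ(t) = u_x² dx` for a.e. `t`, the weak form of the first equation with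
  `F (x, t) = ∫_{-∞}^x dμ(t)`, and `dμ_ac(t) = u_x² dx` for all `t`. -/
  exists_ux : ∃ ux : ℝ → ℝ → ℝ,
    (∀ t, IsWeakDeriv (u t) (ux t) ∧ MemLp (ux t) 2 volume) ∧
    (∀ᵐ t : ℝ, (μ t : Measure ℝ) =
      volume.withDensity (fun x => ENNReal.ofReal (ux t x ^ 2))) ∧
    (∀ φ : ℝ × ℝ → ℝ, IsTestFunction φ →
      ∫ t, ∫ x, (u t x * dt φ x t -
        φ (x, t) * (u t x * ux t x - (1 / 2) * (μ t : Measure ℝ).real (Iic x))) = 0) ∧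
    (∀ t, AcPartEqSq (μ t : Measure ℝ) (ux t))
  /-- The weak form of `μ_t + (u μ)_x = 0`. -/
  energy : ∀ φ : ℝ × ℝ → ℝ, IsTestFunction φ →
    ∫ t, ∫ x, (dt φ x t + u t x * dx φ x t) ∂(μ t : Measure ℝ) = 0

/-! ### The explicit characteristics and the explicit solution -/

/-- The map `x̄`, `x̄(α) = sup {x | x + μ₀((-∞, x)) ≤ α}`. -/
def xbar (μ₀ : FiniteMeasure ℝ) (α : ℝ) : ℝ :=
  sSup {x : ℝ | x + (μ₀ : Measure ℝ).real (Iio x) ≤ α}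

/-- `x̄(α)` satisfies `x̄(α) + μ₀((-∞, x̄(α))) ≤ α ≤ x̄(α) + μ₀((-∞, x̄(α)])`. -/
theorem xbar_spec (μ₀ : FiniteMeasure ℝ) (α : ℝ) :
    xbar μ₀ α + (μ₀ : Measure ℝ).real (Iio (xbar μ₀ α)) ≤ α ∧
      α ≤ xbar μ₀ α + (μ₀ : Measure ℝ).real (Iic (xbar μ₀ α)) := by
  set m : Measure ℝ := (μ₀ : Measure ℝ) with hm
  set S : Set ℝ := {x : ℝ | x + m.real (Iio x) ≤ α} with hS
  have hbdd : BddAbove S :=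
    ⟨α, fun x hx => by
      have h1 : x + m.real (Iio x) ≤ α := hx
      have h2 : 0 ≤ m.real (Iio x) := measureReal_nonneg
      linarith⟩
  have hne : S.Nonempty := by
    refine ⟨α - m.real univ, ?_⟩
    have h1 : m.real (Iio (α - m.real univ)) ≤ m.real univ := measureReal_mono (subset_univ _)
    change α - m.real univ + m.real (Iio (α - m.real univ)) ≤ α
    linarith
  have hx : xbar μ₀ α = sSup S := rfl
  rw [hx]
  set s := sSup S
  have hε : Tendsto (fun n : ℕ => 1 / ((n : ℝ) + 1)) atTop (𝓝 0) :=
    tendsto_one_div_add_atTop_nhds_zero_nat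
  have hpos : ∀ n : ℕ, 0 < 1 / ((n : ℝ) + 1) := fun n => by positivity
  have hanti : Antitone (fun n : ℕ => 1 / ((n : ℝ) + 1)) := fun a b hab => by
    apply one_div_le_one_div_of_le (by positivity)
    have : (a : ℝ) ≤ b := by exact_mod_cast hab
    linarith
  constructor
  · have hU : (⋃ n : ℕ, Iio (s - 1 / ((n : ℝ) + 1))) = Iio s := by
      ext z
      simp only [mem_iUnion, mem_Iio]
      constructor
      · rintro ⟨n, hn⟩
        linarith [hpos n]
      · intro hz
        obtain ⟨n, hn⟩ := exists_nat_one_div_lt (sub_pos.2 hz)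
        exact ⟨n, by linarith⟩
    have hlim : Tendsto (fun n : ℕ => m.real (Iio (s - 1 / ((n : ℝ) + 1)))) atTop
        (𝓝 (m.real (Iio s))) := by
      have h1 : Tendsto (fun n : ℕ => m (Iio (s - 1 / ((n : ℝ) + 1)))) atTop (𝓝 (m (Iio s))) := by
        rw [← hU]
        exact tendsto_measure_iUnion_atTop
          (fun a b hab => Iio_subset_Iio (by linarith [hanti hab]))
      exact (ENNReal.tendsto_toReal (measure_ne_top m _)).comp h1
    have hlim2 : Tendsto (fun n : ℕ => (s - 1 / ((n : ℝ) + 1)) +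
        m.real (Iio (s - 1 / ((n : ℝ) + 1)))) atTop (𝓝 ((s - 0) + m.real (Iio s))) :=
      (tendsto_const_nhds.sub hε).add hlim
    rw [sub_zero] at hlim2
    refine le_of_tendsto' hlim2 fun n => ?_
    obtain ⟨x, hxS, hlt⟩ := exists_lt_of_lt_csSup hne
      (show s - 1 / ((n : ℝ) + 1) < s by linarith [hpos n])
    have h1 : x + m.real (Iio x) ≤ α := hxS
    have h2 : m.real (Iio (s - 1 / ((n : ℝ) + 1))) ≤ m.real (Iio x) :=
      measureReal_mono (Iio_subset_Iio hlt.le)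
    linarith
  · have hI : (⋂ n : ℕ, Iio (s + 1 / ((n : ℝ) + 1))) = Iic s := by
      ext z
      simp only [mem_iInter, mem_Iio, mem_Iic]
      constructor
      · intro h
        by_contra hz
        obtain ⟨n, hn⟩ := exists_nat_one_div_lt (sub_pos.2 (not_le.1 hz))
        linarith [h n]
      · intro hz n
        linarith [hpos n]
    have hlim : Tendsto (fun n : ℕ => m.real (Iio (s + 1 / ((n : ℝ) + 1)))) atTop
        (𝓝 (m.real (Iic s))) := by
      have h1 : Tendsto (fun n : ℕ => m (Iio (s + 1 / ((n : ℝ) + 1)))) atTop (𝓝 (m (Iic s))) := by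
        rw [← hI]
        exact tendsto_measure_iInter_atTop (fun n => measurableSet_Iio.nullMeasurableSet)
          (fun a b hab => Iio_subset_Iio (by linarith [hanti hab])) ⟨0, measure_ne_top m _⟩
      exact (ENNReal.tendsto_toReal (measure_ne_top m _)).comp h1
    have hlim2 : Tendsto (fun n : ℕ => (s + 1 / ((n : ℝ) + 1)) +
        m.real (Iio (s + 1 / ((n : ℝ) + 1)))) atTop (𝓝 ((s + 0) + m.real (Iic s))) :=
      (tendsto_const_nhds.add hε).add hlim
    rw [add_zero] at hlim2
    refine ge_of_tendsto' hlim2 fun n => ?_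
    by_contra hcon
    have hmem : s + 1 / ((n : ℝ) + 1) ∈ S := le_of_lt (not_le.1 hcon)
    have := le_csSup hbdd hmem
    linarith [hpos n, show sSup S = s from rfl]

/-- The two inequalities in `xbar_spec` determine `x̄(α)`. -/
theorem eq_xbar (μ₀ : FiniteMeasure ℝ) (α x : ℝ)
    (h₁ : x + (μ₀ : Measure ℝ).real (Iio x) ≤ α) (h₂ : α ≤ x + (μ₀ : Measure ℝ).real (Iic x)) :
    x = xbar μ₀ α := by
  obtain ⟨k₁, k₂⟩ := xbar_spec μ₀ α
  rcases lt_trichotomy x (xbar μ₀ α) with h | h | h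
  · have : (μ₀ : Measure ℝ).real (Iic x) ≤ (μ₀ : Measure ℝ).real (Iio (xbar μ₀ α)) :=
      measureReal_mono (fun z (hz : z ≤ x) => lt_of_le_of_lt hz h)
    linarith
  · exact h
  · have : (μ₀ : Measure ℝ).real (Iic (xbar μ₀ α)) ≤ (μ₀ : Measure ℝ).real (Iio x) :=
      measureReal_mono (fun z (hz : z ≤ xbar μ₀ α) => lt_of_le_of_lt hz h)
    linarith

/-- `y(α, t) = x̄(α) + u₀(x̄(α)) t + (t²/4) (α - x̄(α))`. -/
def yMap (u₀ : ℝ →ᵇ ℝ) (μ₀ : FiniteMeasure ℝ) (α t : ℝ) : ℝ :=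
  xbar μ₀ α + u₀ (xbar μ₀ α) * t + t ^ 2 / 4 * (α - xbar μ₀ α)

/-- `∂_t y(α, t) = u₀(x̄(α)) + (t/2) (α - x̄(α))`. -/
def yVel (u₀ : ℝ →ᵇ ℝ) (μ₀ : FiniteMeasure ℝ) (α t : ℝ) : ℝ :=
  u₀ (xbar μ₀ α) + t / 2 * (α - xbar μ₀ α)

theorem hasDerivAt_yMap (u₀ : ℝ →ᵇ ℝ) (μ₀ : FiniteMeasure ℝ) (α t : ℝ) :
    HasDerivAt (yMap u₀ μ₀ α) (yVel u₀ μ₀ α t) t := by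
  have h1 : HasDerivAt (fun s : ℝ => xbar μ₀ α + u₀ (xbar μ₀ α) * s)
      (u₀ (xbar μ₀ α) * 1) t := ((hasDerivAt_id t).const_mul _).const_add _
  have h2 : HasDerivAt (fun s : ℝ => s ^ 2 / 4 * (α - xbar μ₀ α))
      ((2 : ℕ) * t ^ (2 - 1) / 4 * (α - xbar μ₀ α)) t :=
    ((hasDerivAt_pow 2 t).div_const 4).mul_const _
  have h3 := h1.add h2
  refine HasDerivAt.congr_deriv h3 ?_
  simp only [yVel]
  push_cast
  ring

/-- The function `u` of the explicit solution: `u(x, t) = ∂_t y(α, t)` for `x = y(α, t)`.  Here `α`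
is taken to be the smallest label with `y(α, t) = x`. -/
def explicitU (u₀ : ℝ →ᵇ ℝ) (μ₀ : FiniteMeasure ℝ) (t x : ℝ) : ℝ :=
  yVel u₀ μ₀ (sInf {α : ℝ | yMap u₀ μ₀ α t = x}) t

/-- The energy measure of the explicit solution: the push-forward `μ(t) = y(·, t) # (f dα)` with
`f(α) = 1 - x̄'(α)`. -/
def explicitMu (u₀ : ℝ →ᵇ ℝ) (μ₀ : FiniteMeasure ℝ) (t : ℝ) : Measure ℝ :=
  Measure.map (fun α => yMap u₀ μ₀ α t)
    (volume.withDensity (fun α => ENNReal.ofReal (1 - deriv (xbar μ₀) α)))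

/-- `γ` is a characteristic of `(v, ν)` with label `α`: it solves `γ'(t) = v(γ(t), t)`,
`γ(0) = x̄(α)`, and `ν(t)((-∞, γ(t))) ≤ α - x̄(α) ≤ ν(t)((-∞, γ(t)])` for a.e. `t`. -/
structure IsCharacteristic (μ₀ : FiniteMeasure ℝ) (v : ℝ → (ℝ →ᵇ ℝ)) (ν : ℝ → FiniteMeasure ℝ)
    (α : ℝ) (γ : ℝ → ℝ) : Prop where
  hasDerivAt : ∀ t, HasDerivAt γ (v t (γ t)) t
  initial : γ 0 = xbar μ₀ α
  energy : ∀ᵐ t : ℝ, (ν t : Measure ℝ).real (Iio (γ t)) ≤ α - xbar μ₀ α ∧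
    α - xbar μ₀ α ≤ (ν t : Measure ℝ).real (Iic (γ t))

end HunterSaxton

end

noncomputable section

namespace HunterSaxton

/-! ### Weak derivatives on the line -/

/-! The velocity `v` is only Hölder continuous, so the ODE `γ' = v(γ, t)` need not have unique
solutions; the energy selects one. In one dimension the continuity equation says that energy does
not cross a point moving with the fluid, so for a level `a > 0` the left quantile of `ν t` should be
a characteristic. `hasDerivAt_quantile` proves this with barriers: near a given point `v` is within
`δ` of a constant, and energy fluxes through windows of speed `c ± δ` have a sign.

Along any curve with energy `a` on its left for a.e. time, the velocity is affine in time
(`velocity_eq`). The momentum in `[γ, γ + ε]` changes at the rate `½ ∫ F - ½ (v(γ + ε) - v(γ))²`.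
After division by `ε` the first term tends to `a / 2`. The second is at most half the energy in `(γ,
γ + ε)`, by Cauchy-Schwarz and `u_x² dx ≤ dν`, and so vanishes. Hence every such characteristic is a
parabola fixed by the initial data, which is uniqueness.

For existence, the parabola of a label is compared with quantile parabolas. Parabolas of different
levels do not cross, because `(Δu₀)² ≤ Δx Δa` makes the difference a quadratic in `t` of nonpositive
discriminant (`parabola_le_quantile`). Between parabolas of the same level there is initially no
energy, so `u₀` is constant there and they are translates. Letting the level decrease to `a` gives
the energy bounds and the velocity for every label (`real_Iio_parabola_le`, `velocity_parabola`);
the top level is treated separately. Since `y(·, t)` is continuous, monotone and onto, this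
determines `v`, and comparing distribution functions identifies `ν t` with the push-forward. -/

theorem exists_pos_forall_abs_le_of_hasCompactSupport {φ : ℝ → ℝ} (hc : HasCompactSupport φ) :
    ∃ R : ℝ, 0 < R ∧ ∀ x, R ≤ |x| → φ x = 0 := by
  obtain ⟨R, hR⟩ := hc.isCompact.isBounded.subset_closedBall 0
  refine ⟨max R 0 + 1, by positivity, fun x hx => ?_⟩
  by_contra h
  have h1 := hR (subset_tsupport φ h)
  rw [Metric.mem_closedBall, Real.dist_eq, sub_zero] at h1
  linarith [le_max_left R 0]

theorem integral_eq_intervalIntegral_of_forall_abs_le {h : ℝ → ℝ} {R : ℝ}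
    (hh : ∀ x, R ≤ |x| → h x = 0) : ∫ x, h x = ∫ x in (-R)..R, h x := by
  refine (intervalIntegral.integral_eq_integral_of_support_subset fun x hx => ?_).symm
  have h1 : |x| < R := by
    by_contra hcon
    exact hx (hh x (not_lt.1 hcon))
  exact ⟨(abs_lt.1 h1).1, (abs_lt.1 h1).2.le⟩

/-- Integration by parts on the line for a locally absolutely continuous function and a compactly
supported `C¹` function. -/
theorem integral_mul_deriv_eq_neg {f g φ : ℝ → ℝ}
    (hf : ∀ a b, AbsolutelyContinuousOnInterval f a b) (hfg : ∀ᵐ x, HasDerivAt f (g x) x)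
    (hφ : ContDiff ℝ 1 φ) (hc : HasCompactSupport φ) :
    ∫ x, f x * deriv φ x = -∫ x, g x * φ x := by
  obtain ⟨R, hR0, hR⟩ := exists_pos_forall_abs_le_of_hasCompactSupport hc
  obtain ⟨R', hR0', hR'⟩ := exists_pos_forall_abs_le_of_hasCompactSupport hc.deriv
  set T := max R R'
  rw [integral_eq_intervalIntegral_of_forall_abs_le (R := T)
      (fun x hx => by rw [hR' x ((le_max_right _ _).trans hx), mul_zero]),
    integral_eq_intervalIntegral_of_forall_abs_le (R := T)
      (fun x hx => by rw [hR x ((le_max_left _ _).trans hx), mul_zero]),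
    (hf _ _).integral_mul_deriv_eq_deriv_mul hφ.contDiffOn.absolutelyContinuousOnInterval,
    hR T ((le_max_left _ _).trans (le_abs_self _)),
    hR (-T) (by rw [abs_neg]; exact (le_max_left _ _).trans (le_abs_self _))]
  simp only [mul_zero, sub_zero, zero_sub, neg_inj]
  refine intervalIntegral.integral_congr_ae ?_
  filter_upwards [hfg] with x hx _
  rw [hx.deriv]

theorem intervalIntegrable_of_locallyIntegrable {g : ℝ → ℝ} (hg : LocallyIntegrable g)
    (a b : ℝ) : IntervalIntegrable g volume a b :=
  intervalIntegrable_iff.mpr <|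
    (hg.integrableOn_isCompact isCompact_uIcc).mono_set uIoc_subset_uIcc

theorem absolutelyContinuousOnInterval_primitive {g : ℝ → ℝ} (hg : LocallyIntegrable g)
    (a b : ℝ) : AbsolutelyContinuousOnInterval (fun x => ∫ z in (0 : ℝ)..x, g z) a b := by
  -- The interval is enlarged to contain the base point `0` of the primitive.
  have h1 := (intervalIntegrable_of_locallyIntegrable hg (min (min a b) 0)
    (max (max a b) 0)).absolutelyContinuousOnInterval_intervalIntegral (c := 0) (by
      rw [uIcc_of_le ((min_le_right _ _).trans (le_max_right _ _))]
      exact ⟨min_le_right _ _, le_max_right _ _⟩)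
  refine h1.mono ?_
  rw [uIcc_of_le ((min_le_right (min a b) 0).trans (le_max_right _ _))]
  exact Icc_subset_Icc (min_le_left _ _) (le_max_left _ _)

/-- The lemma of du Bois-Reymond. -/
theorem exists_eq_const_of_integral_mul_deriv_eq_zero {N : ℝ → ℝ} (hN : Continuous N)
    (h : ∀ φ : ℝ → ℝ, ContDiff ℝ ∞ φ → HasCompactSupport φ → ∫ x, N x * deriv φ x = 0) :
    ∃ C, ∀ x, N x = C := by
  let η : ContDiffBump (0 : ℝ) := ⟨1, 2, one_pos, one_lt_two⟩
  set ρ : ℝ → ℝ := η.normed volume with hρ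
  have hρs : ContDiff ℝ ∞ ρ := η.contDiff_normed
  have hρc : HasCompactSupport ρ := η.hasCompactSupport_normed
  have hρi : ∫ x, ρ x = 1 := η.integral_normed
  have hint : ∀ g : ℝ → ℝ, Continuous g → HasCompactSupport g → Integrable (fun x => g x * N x) :=
    fun g hg hgc => (hg.mul hN).integrable_of_hasCompactSupport hgc.mul_right
  refine ⟨∫ x, ρ x * N x, ?_⟩
  set C := ∫ x, ρ x * N x with hC
  have key : ∀ᵐ x, N x - C = 0 := by
    refine ae_eq_zero_of_integral_contDiff_smul_eq_zero
      ((hN.sub continuous_const).locallyIntegrable) fun g hg hgc => ?_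
    set c := ∫ x, g x with hc
    -- Subtracting a multiple of the unit bump leaves integral zero, so `w` is the derivative of a
    -- compactly supported test function.
    set w : ℝ → ℝ := fun x => g x - c * ρ x with hw
    have hwc : ContDiff ℝ ∞ w := hg.sub (contDiff_const.mul hρs)
    have hwsupp : HasCompactSupport w := hgc.sub hρc.mul_left
    have hwi : ∫ x, w x = 0 := by
      rw [integral_sub (hg.continuous.integrable_of_hasCompactSupport hgc)
        ((hρs.continuous.integrable_of_hasCompactSupport hρc).const_mul c),
        integral_const_mul, hρi, mul_one, sub_self]
    obtain ⟨R, hR0, hR⟩ := exists_pos_forall_abs_le_of_hasCompactSupport hwsupp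
    set φ : ℝ → ℝ := fun x => ∫ z in (-R)..x, w z with hφ
    have hd : ∀ x, HasDerivAt φ (w x) x := fun x =>
      intervalIntegral.integral_hasDerivAt_right (hwc.continuous.intervalIntegrable _ _)
        (hwc.continuous.stronglyMeasurableAtFilter _ _) hwc.continuous.continuousAt
    have hderiv : deriv φ = w := funext fun x => (hd x).deriv
    have hφs : ContDiff ℝ ∞ φ := by
      rw [contDiff_infty_iff_deriv]
      exact ⟨fun x => (hd x).differentiableAt, by rw [hderiv]; exact hwc⟩
    have hφc : HasCompactSupport φ := by
      refine HasCompactSupport.of_support_subset_isCompact (isCompact_Icc (a := -R) (b := R)) ?_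
      intro x hx
      by_contra hcon
      apply hx
      rw [mem_Icc, not_and_or, not_le, not_le] at hcon
      rcases hcon with h1 | h1
      · change ∫ z in (-R)..x, w z = 0
        rw [intervalIntegral.integral_congr (g := fun _ => (0 : ℝ)), intervalIntegral.integral_zero]
        intro z hz
        rw [uIcc_of_ge h1.le] at hz
        exact hR z (by rw [abs_of_nonpos (by linarith [hz.2])]; linarith [hz.2])
      · change ∫ z in (-R)..x, w z = 0
        rw [← intervalIntegral.integral_add_adjacent_intervals
          (hwc.continuous.intervalIntegrable (-R) R) (hwc.continuous.intervalIntegrable R x),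
          ← integral_eq_intervalIntegral_of_forall_abs_le hR, hwi, zero_add,
          intervalIntegral.integral_congr (g := fun _ => (0 : ℝ)), intervalIntegral.integral_zero]
        intro z hz
        rw [uIcc_of_le h1.le] at hz
        exact hR z (by rw [abs_of_nonneg (by linarith [hz.1])]; exact hz.1)
    have h0 := h φ hφs hφc
    rw [hderiv] at h0
    have e1 : ∫ x, g x • (N x - C) = (∫ x, g x * N x) - c * C := by
      rw [hc, ← integral_mul_const, ← integral_sub (hint g hg.continuous hgc)
        ((hg.continuous.integrable_of_hasCompactSupport hgc).mul_const C)]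
      exact integral_congr_ae (ae_of_all _ fun x => by simp only [smul_eq_mul]; ring)
    have e2 : ∫ x, N x * w x = (∫ x, g x * N x) - c * C := by
      rw [hC, ← integral_const_mul, ← integral_sub (hint g hg.continuous hgc)
        ((hint ρ hρs.continuous hρc).const_mul c)]
      exact integral_congr_ae (ae_of_all _ fun x => by simp only [hw]; ring)
    rw [e1, ← e2, h0]
  have heq : (fun x => N x - C) = fun _ => (0 : ℝ) :=
    (hN.sub continuous_const).ae_eq_iff_eq volume continuous_const |>.1 key
  intro x
  have := congrFun heq x
  linarith

/-- A continuous function with a weak derivative satisfies the fundamental theorem of calculus. -/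
theorem IsWeakDeriv.sub_eq_integral {f g : ℝ → ℝ} (h : IsWeakDeriv f g) (hf : Continuous f)
    (a b : ℝ) : f b - f a = ∫ x in a..b, g x := by
  have hg := h.locallyIntegrable_deriv
  have hgi := intervalIntegrable_of_locallyIntegrable hg
  set P : ℝ → ℝ := fun x => ∫ z in (0 : ℝ)..x, g z with hP
  have hPc : Continuous P := intervalIntegral.continuous_primitive hgi 0
  -- The difference of `f` and the primitive of `g` has zero weak derivative.
  obtain ⟨C, hC⟩ := exists_eq_const_of_integral_mul_deriv_eq_zero (hf.sub hPc) (by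
    intro φ hφ hφc
    have hd : Continuous (deriv φ) := hφ.continuous_deriv (by simp)
    have e1 := h.integral_eq φ hφ hφc
    have e2 : ∫ x, P x * deriv φ x = -∫ x, g x * φ x :=
      integral_mul_deriv_eq_neg (absolutelyContinuousOnInterval_primitive hg)
        ((_root_.LocallyIntegrable.ae_hasDerivAt_integral hg).mono fun x hx => hx 0) (hφ.of_le (by simp)) hφc
    have e3 : ∫ x, (f - P) x * deriv φ x
        = (∫ x, f x * deriv φ x) - ∫ x, P x * deriv φ x := by
      have i1 : Integrable (fun x => f x * deriv φ x) :=
        (hf.mul hd).integrable_of_hasCompactSupport hφc.deriv.mul_left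
      have i2 : Integrable (fun x => P x * deriv φ x) :=
        (hPc.mul hd).integrable_of_hasCompactSupport hφc.deriv.mul_left
      rw [← integral_sub i1 i2]
      exact integral_congr_ae (ae_of_all _ fun x => by simp only [Pi.sub_apply]; ring)
    rw [e3, e1, e2, sub_self])
  have ha := hC a
  have hb := hC b
  have hab := intervalIntegral.integral_interval_sub_left (hgi 0 b) (hgi 0 a)
  simp only [Pi.sub_apply, hP] at ha hb
  rw [← hab]
  linarith

/-- A continuous function with a weak derivative is locally absolutely continuous. -/
theorem IsWeakDeriv.eq_add_primitive {f g : ℝ → ℝ} (h : IsWeakDeriv f g) (hf : Continuous f) :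
    f = fun x => f 0 + ∫ z in (0 : ℝ)..x, g z := by
  funext x
  rw [← h.sub_eq_integral hf 0 x]
  ring

theorem IsWeakDeriv.absolutelyContinuousOnInterval {f g : ℝ → ℝ} (h : IsWeakDeriv f g)
    (hf : Continuous f) (a b : ℝ) : AbsolutelyContinuousOnInterval f a b := by
  rw [h.eq_add_primitive hf]
  exact (contDiff_const (c := f 0)).contDiffOn.absolutelyContinuousOnInterval.fun_add
    (absolutelyContinuousOnInterval_primitive h.locallyIntegrable_deriv a b)

theorem IsWeakDeriv.ae_hasDerivAt {f g : ℝ → ℝ} (h : IsWeakDeriv f g) (hf : Continuous f) :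
    ∀ᵐ x, HasDerivAt f (g x) x := by
  filter_upwards [_root_.LocallyIntegrable.ae_hasDerivAt_integral h.locallyIntegrable_deriv] with x hx
  rw [h.eq_add_primitive hf]
  exact (hx 0).const_add _

/-- `f² / 2` is locally absolutely continuous with derivative `f g`; this puts `u u_x` in divergence
form. -/
theorem IsWeakDeriv.integral_mul_mul {f g φ : ℝ → ℝ} (h : IsWeakDeriv f g) (hf : Continuous f)
    (hφ : ContDiff ℝ 1 φ) (hc : HasCompactSupport φ) :
    ∫ x, f x * g x * φ x = -∫ x, f x ^ 2 / 2 * deriv φ x := by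
  have hac := h.absolutelyContinuousOnInterval hf
  have key := integral_mul_deriv_eq_neg (f := fun x => f x ^ 2 / 2) (g := fun x => f x * g x)
    (fun a b => by
      have := ((hac a b).fun_mul (hac a b)).const_mul (1 / 2)
      refine (show (fun x => f x ^ 2 / 2) = fun x => 1 / 2 * (f x * f x) from ?_) ▸ this
      funext x
      ring)
    (by
      filter_upwards [h.ae_hasDerivAt hf] with x hx
      refine ((hx.pow 2).div_const 2).congr_deriv ?_
      simp only [Nat.cast_ofNat, Nat.add_one_sub_one, pow_one]
      ring) hφ hc
  rw [key, neg_neg]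

/-! ### Pairings with time dependent measures and the transport identity -/

theorem integrable_bcf (μ : FiniteMeasure ℝ) (f : ℝ →ᵇ ℝ) :
    Integrable f (μ : Measure ℝ) :=
  f.integrable _

theorem abs_integral_bcf_le (μ : FiniteMeasure ℝ) (f : ℝ →ᵇ ℝ) :
    |∫ x, f x ∂(μ : Measure ℝ)| ≤ ‖f‖ * (μ : Measure ℝ).real univ := by
  have := f.norm_integral_le_mul_norm (μ := (μ : Measure ℝ))
  rw [Real.norm_eq_abs] at this
  linarith [mul_comm ‖f‖ ((μ : Measure ℝ).real univ)]

theorem continuous_real_univ {X : Type*} [TopologicalSpace X] {ν : X → FiniteMeasure ℝ}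
    (hν : Continuous ν) : Continuous fun t => (ν t : Measure ℝ).real univ := by
  have h := NNReal.continuous_coe.comp (FiniteMeasure.continuous_mass.comp hν)
  exact h

/-- The pairing of bounded continuous functions (with the uniform norm) and finite measures (with
the weak topology) is jointly continuous. -/
theorem continuous_integral_bcf {X : Type*} [TopologicalSpace X] {f : X → (ℝ →ᵇ ℝ)}
    {ν : X → FiniteMeasure ℝ} (hf : Continuous f) (hν : Continuous ν) :
    Continuous fun t => ∫ x, f t x ∂(ν t : Measure ℝ) := by
  rw [continuous_iff_continuousAt]
  intro t
  have h1 : Tendsto (fun s => ∫ x, f t x ∂(ν s : Measure ℝ)) (𝓝 t)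
      (𝓝 (∫ x, f t x ∂(ν t : Measure ℝ))) :=
    FiniteMeasure.tendsto_iff_forall_integral_tendsto.1 (hν.tendsto t) (f t)
  -- The change of the integrand is small in sup norm, and the masses converge.
  have h2 : Tendsto (fun s => ∫ x, (f s - f t) x ∂(ν s : Measure ℝ)) (𝓝 t) (𝓝 0) := by
    refine squeeze_zero_norm (fun s => abs_integral_bcf_le (ν s) (f s - f t)) ?_
    have h3 : Tendsto (fun s => ‖f s - f t‖ * (ν s : Measure ℝ).real univ) (𝓝 t)
        (𝓝 (‖f t - f t‖ * (ν t : Measure ℝ).real univ)) :=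
      ((hf.tendsto t).sub tendsto_const_nhds).norm.mul ((continuous_real_univ hν).tendsto t)
    simpa using h3
  have h3 := h2.add h1
  rw [zero_add] at h3
  refine h3.congr fun s => ?_
  rw [← integral_add (integrable_bcf _ _) (integrable_bcf _ _)]
  exact integral_congr_ae (ae_of_all _ fun x => by simp)

/-- The translate `x ↦ ρ (x - c t)`. -/
def shift (ρ : ℝ →ᵇ ℝ) (c t : ℝ) : ℝ →ᵇ ℝ :=
  ρ.compContinuous ⟨fun x => x - c * t, by fun_prop⟩

@[simp] theorem shift_apply (ρ : ℝ →ᵇ ℝ) (c t x : ℝ) : shift ρ c t x = ρ (x - c * t) := rfl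

theorem continuous_shift {ρ : ℝ →ᵇ ℝ} (hρ : UniformContinuous ρ) (c : ℝ) :
    Continuous (shift ρ c) := by
  rw [Metric.continuous_iff]
  intro t ε hε
  obtain ⟨δ, hδ, h⟩ := Metric.uniformContinuous_iff.1 hρ (ε / 2) (half_pos hε)
  refine ⟨δ / (|c| + 1), by positivity, fun s hs => ?_⟩
  refine lt_of_le_of_lt ((BoundedContinuousFunction.dist_le (half_pos hε).le).2 fun x => ?_)
    (half_lt_self hε)
  refine (h ?_).le
  rw [Real.dist_eq] at hs ⊢
  have h1 : x - c * s - (x - c * t) = -(c * (s - t)) := by ring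
  change |x - c * s - (x - c * t)| < δ
  rw [h1, abs_neg, abs_mul]
  rw [lt_div_iff₀ (by positivity)] at hs
  nlinarith [abs_nonneg (s - t), abs_nonneg c]

/-- A compactly supported continuous function as a bounded continuous function. -/
def bcfOfCompact (ρ : ℝ → ℝ) (h : Continuous ρ) (hc : HasCompactSupport ρ) : ℝ →ᵇ ℝ :=
  BoundedContinuousFunction.ofNormedAddCommGroup ρ h (hc.exists_bound_of_continuous h).choose
    (hc.exists_bound_of_continuous h).choose_spec

@[simp] theorem bcfOfCompact_apply (ρ : ℝ → ℝ) (h : Continuous ρ) (hc : HasCompactSupport ρ)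
    (x : ℝ) : bcfOfCompact ρ h hc x = ρ x := rfl

theorem uniformContinuous_bcfOfCompact (ρ : ℝ → ℝ) (h : Continuous ρ) (hc : HasCompactSupport ρ) :
    UniformContinuous (bcfOfCompact ρ h hc) :=
  hc.uniformContinuous_of_continuous h

/-- The factor `ρ` is a window moving with speed `c`; `χ` remains free as a test function in time
alone. -/
theorem isTestFunction_shift_mul {ρ χ : ℝ → ℝ} (hρ : ContDiff ℝ ∞ ρ) (hρc : HasCompactSupport ρ)
    (hχ : ContDiff ℝ ∞ χ) (hχc : HasCompactSupport χ) (c : ℝ) :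
    IsTestFunction fun p : ℝ × ℝ => ρ (p.1 - c * p.2) * χ p.2 := by
  constructor
  · exact (hρ.comp (contDiff_fst.sub (contDiff_const.mul contDiff_snd))).mul
      (hχ.comp contDiff_snd)
  · obtain ⟨R, hR0, hR⟩ := exists_pos_forall_abs_le_of_hasCompactSupport hρc
    obtain ⟨T, hT0, hT⟩ := exists_pos_forall_abs_le_of_hasCompactSupport hχc
    refine HasCompactSupport.of_support_subset_isCompact
      ((isCompact_Icc (a := -(R + |c| * T)) (b := R + |c| * T)).prod
        (isCompact_Icc (a := -T) (b := T))) ?_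
    rintro ⟨x, t⟩ hp
    have h1 : |x - c * t| < R := by
      by_contra hcon
      exact hp (by simp [hR _ (not_lt.1 hcon)])
    have h2 : |t| < T := by
      by_contra hcon
      exact hp (by simp [hT _ (not_lt.1 hcon)])
    have h3 : |x| ≤ R + |c| * T := by
      have h4 : |x| ≤ |x - c * t| + |c * t| := by
        simpa using abs_add_le (x - c * t) (c * t)
      rw [abs_mul] at h4
      nlinarith [abs_nonneg c]
    exact ⟨abs_le.1 h3, abs_le.1 h2.le⟩

theorem dx_shift_mul {ρ : ℝ → ℝ} (hρ : ContDiff ℝ ∞ ρ) (χ : ℝ → ℝ) (c x t : ℝ) :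
    dx (fun p : ℝ × ℝ => ρ (p.1 - c * p.2) * χ p.2) x t = deriv ρ (x - c * t) * χ t := by
  have h1 : HasDerivAt ρ (deriv ρ (x - c * t)) (x - c * t) :=
    (hρ.differentiable (by simp)).differentiableAt.hasDerivAt
  have h2 : HasDerivAt (fun z : ℝ => z - c * t) 1 x := (hasDerivAt_id x).sub_const _
  have h3 := (h1.comp x h2).mul_const (χ t)
  rw [mul_one] at h3
  exact h3.deriv

theorem dt_shift_mul {ρ χ : ℝ → ℝ} (hρ : ContDiff ℝ ∞ ρ) (hχ : ContDiff ℝ ∞ χ) (c x t : ℝ) :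
    dt (fun p : ℝ × ℝ => ρ (p.1 - c * p.2) * χ p.2) x t =
      -c * deriv ρ (x - c * t) * χ t + ρ (x - c * t) * deriv χ t := by
  have h1 : HasDerivAt ρ (deriv ρ (x - c * t)) (x - c * t) :=
    (hρ.differentiable (by simp)).differentiableAt.hasDerivAt
  have h2 : HasDerivAt (fun s : ℝ => x - c * s) (-c) t := by
    simpa using ((hasDerivAt_id t).const_mul c).const_sub x
  have h4 : HasDerivAt χ (deriv χ t) t :=
    (hχ.differentiable (by simp)).differentiableAt.hasDerivAt
  have h3 := (h1.comp t h2).mul h4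
  refine Eq.trans h3.deriv ?_
  simp only [Function.comp]
  ring

namespace IsConservativeSolution

variable {u₀ : ℝ →ᵇ ℝ} {μ₀ : FiniteMeasure ℝ} {v : ℝ → (ℝ →ᵇ ℝ)} {ν : ℝ → FiniteMeasure ℝ}

/-- The energy in a window moving with speed `c` changes by the flux relative to the window. -/
theorem transport (hv : IsConservativeSolution u₀ μ₀ v ν) {ρ : ℝ → ℝ} (hρ : ContDiff ℝ ∞ ρ)
    (hρc : HasCompactSupport ρ) (c t₁ t₂ : ℝ) :
    (∫ x, ρ (x - c * t₂) ∂(ν t₂ : Measure ℝ)) - ∫ x, ρ (x - c * t₁) ∂(ν t₁ : Measure ℝ) =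
      ∫ t in t₁..t₂, ∫ x, deriv ρ (x - c * t) * (v t x - c) ∂(ν t : Measure ℝ) := by
  have hdc : Continuous (deriv ρ) := hρ.continuous_deriv (by simp)
  set r := bcfOfCompact ρ hρ.continuous hρc with hr
  set r' := bcfOfCompact (deriv ρ) hdc hρc.deriv with hr'
  set fE : ℝ → (ℝ →ᵇ ℝ) := fun t => shift r c t
  set fD : ℝ → (ℝ →ᵇ ℝ) := fun t =>
    shift r' c t * (v t - BoundedContinuousFunction.const ℝ c) with hfD
  have hfE : Continuous fE := continuous_shift (uniformContinuous_bcfOfCompact _ _ _) c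
  have hfDc : Continuous fD :=
    (continuous_shift (uniformContinuous_bcfOfCompact _ _ _) c).mul
      (hv.continuous_u.sub continuous_const)
  have hE := continuous_integral_bcf hfE hv.continuous_μ
  have hD := continuous_integral_bcf hfDc hv.continuous_μ
  -- Testing with all `χ` says that the windowed energy has the flux as weak time derivative. The
  -- energy is continuous in time, so the identity holds between any two times.
  refine IsWeakDeriv.sub_eq_integral (f := fun t => ∫ x, fE t x ∂(ν t : Measure ℝ))
    (g := fun t => ∫ x, fD t x ∂(ν t : Measure ℝ))
    ⟨hE.locallyIntegrable, hD.locallyIntegrable, fun χ hχ hχc => ?_⟩ hE t₁ t₂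
  have h0 := hv.energy _ (isTestFunction_shift_mul hρ hρc hχ hχc c)
  have h1 : ∀ t, ∫ x, (dt (fun p : ℝ × ℝ => ρ (p.1 - c * p.2) * χ p.2) x t +
      v t x * dx (fun p : ℝ × ℝ => ρ (p.1 - c * p.2) * χ p.2) x t) ∂(ν t : Measure ℝ) =
      (∫ x, fE t x ∂(ν t : Measure ℝ)) * deriv χ t + (∫ x, fD t x ∂(ν t : Measure ℝ)) * χ t := by
    intro t
    rw [← integral_mul_const, ← integral_mul_const,
      ← integral_add ((integrable_bcf _ _).mul_const _) ((integrable_bcf _ _).mul_const _)]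
    refine integral_congr_ae (ae_of_all _ fun x => ?_)
    simp only [dt_shift_mul hρ hχ, dx_shift_mul hρ, hfD, fE, shift_apply, hr, hr',
      bcfOfCompact_apply, BoundedContinuousFunction.coe_mul, Pi.mul_apply,
      BoundedContinuousFunction.coe_sub, Pi.sub_apply, BoundedContinuousFunction.const_apply]
    ring
  simp_rw [h1] at h0
  rw [integral_add] at h0
  · linarith
  · exact (hE.mul (hχ.continuous_deriv (by simp))).integrable_of_hasCompactSupport
      hχc.deriv.mul_left
  · exact (hD.mul hχ.continuous).integrable_of_hasCompactSupport hχc.mul_left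

end IsConservativeSolution

/-! ### Distribution functions of finite measures -/

section Distribution

variable (m : Measure ℝ) [IsFiniteMeasure m]

theorem real_Iic_mono {x y : ℝ} (h : x ≤ y) : m.real (Iic x) ≤ m.real (Iic y) :=
  measureReal_mono (Iic_subset_Iic.2 h)

theorem real_Iic_le_real_Iio {x y : ℝ} (h : x < y) : m.real (Iic x) ≤ m.real (Iio y) :=
  measureReal_mono fun _ hz => lt_of_le_of_lt hz h

theorem tendsto_real_Iic_atBot : Tendsto (fun x => m.real (Iic x)) atBot (𝓝 0) := by
  have h1 := tendsto_measure_iInter_atBot (μ := m) (s := fun x : ℝ => Iic x)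
    (fun _ => measurableSet_Iic.nullMeasurableSet) (fun _ _ h => Iic_subset_Iic.2 h)
    ⟨0, measure_ne_top _ _⟩
  have h2 : (⋂ x : ℝ, Iic x) = ∅ := by
    ext z
    simp only [mem_iInter, mem_Iic, mem_empty_iff_false, iff_false, not_forall, not_le]
    exact ⟨z - 1, by linarith⟩
  rw [h2, measure_empty] at h1
  exact (ENNReal.tendsto_toReal ENNReal.zero_ne_top).comp h1

theorem tendsto_real_Iic_atTop : Tendsto (fun x => m.real (Iic x)) atTop (𝓝 (m.real univ)) :=
  (ENNReal.tendsto_toReal (measure_ne_top m univ)).comp (tendsto_measure_Iic_atTop m)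

theorem tendsto_real_Iic_nhdsGT (x : ℝ) :
    Tendsto (fun z => m.real (Iic z)) (𝓝[>] x) (𝓝 (m.real (Iic x))) := by
  have h1 := tendsto_measure_biInter_gt (μ := m) (s := fun z : ℝ => Iic z) (a := x)
    (fun _ _ => measurableSet_Iic.nullMeasurableSet) (fun _ _ _ h => Iic_subset_Iic.2 h)
    ⟨x + 1, by linarith, measure_ne_top _ _⟩
  have h2 : (⋂ z : ℝ, ⋂ (_ : z > x), Iic z) = Iic x := by
    ext w
    simp only [mem_iInter, mem_Iic]
    exact ⟨fun h => le_of_forall_gt_imp_ge_of_dense h, fun h z hz => h.trans hz.le⟩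
  rw [h2] at h1
  exact (ENNReal.tendsto_toReal (measure_ne_top m _)).comp h1

theorem le_real_Iic_of_forall_gt {a x : ℝ} (h : ∀ z, x < z → a ≤ m.real (Iic z)) :
    a ≤ m.real (Iic x) :=
  ge_of_tendsto (tendsto_real_Iic_nhdsGT m x) (eventually_mem_nhdsWithin.mono h)

theorem real_Iio_le_of_forall_lt {a x : ℝ} (h : ∀ z, z < x → m.real (Iic z) ≤ a) :
    m.real (Iio x) ≤ a := by
  have h1 : (⋃ n : ℕ, Iic (x - 1 / ((n : ℝ) + 1))) = Iio x := by
    ext z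
    simp only [mem_iUnion, mem_Iic, mem_Iio]
    constructor
    · rintro ⟨n, hn⟩
      have : (0 : ℝ) < 1 / ((n : ℝ) + 1) := by positivity
      linarith
    · intro hz
      obtain ⟨n, hn⟩ := exists_nat_one_div_lt (sub_pos.2 hz)
      exact ⟨n, by linarith⟩
  have h2 : Monotone fun n : ℕ => Iic (x - 1 / ((n : ℝ) + 1)) := fun i j hij => by
    have h4 := Nat.one_div_le_one_div (α := ℝ) hij
    exact Iic_subset_Iic.2 (by linarith)
  have h3 := tendsto_measure_iUnion_atTop (μ := m) h2
  rw [h1] at h3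
  refine le_of_tendsto' ((ENNReal.tendsto_toReal (measure_ne_top m _)).comp h3) fun n => h _ ?_
  have : (0 : ℝ) < 1 / ((n : ℝ) + 1) := by positivity
  linarith

end Distribution

/-! ### Comparison of the energy on the left of moving points -/

theorem exists_abs_deriv_smoothTransition_le :
    ∃ K, 0 ≤ K ∧ ∀ x, |deriv Real.smoothTransition x| ≤ K := by
  have hc : Continuous (deriv Real.smoothTransition) :=
    (Real.smoothTransition.contDiff (n := 1)).continuous_deriv (by simp)
  have hz : ∀ x, x ∉ Icc (0 : ℝ) 1 → deriv Real.smoothTransition x = 0 := by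
    intro x hx
    rw [mem_Icc, not_and_or, not_le, not_le] at hx
    rcases hx with h | h
    · have : Real.smoothTransition =ᶠ[𝓝 x] fun _ => 0 := by
        filter_upwards [Iio_mem_nhds h] with z hz
        exact Real.smoothTransition.zero_of_nonpos hz.le
      rw [this.deriv_eq, deriv_const]
    · have : Real.smoothTransition =ᶠ[𝓝 x] fun _ => 1 := by
        filter_upwards [Ioi_mem_nhds h] with z hz
        exact Real.smoothTransition.one_of_one_le hz.le
      rw [this.deriv_eq, deriv_const]
  obtain ⟨K, hK⟩ := (HasCompactSupport.intro isCompact_Icc hz).exists_bound_of_continuous hc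
  exact ⟨K, (norm_nonneg _).trans (hK 0), hK⟩

/-- A smooth cutoff that falls from `1` to `0` on `[p, q]` and rises slowly far to the left. -/
theorem exists_cutoff {p q : ℝ} (hpq : p < q) :
    ∃ K, 0 ≤ K ∧ ∀ R, 0 < R → ∃ ρ m e : ℝ → ℝ, ContDiff ℝ ∞ ρ ∧ HasCompactSupport ρ ∧
      (∀ x, 0 ≤ ρ x) ∧ (∀ x, ρ x ≤ 1) ∧ (∀ x, -R < x → x ≤ p → ρ x = 1) ∧
      (∀ x, q < x → ρ x = 0) ∧ (∀ x, deriv ρ x = e x - m x) ∧ (∀ x, 0 ≤ m x) ∧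
      (∀ x, m x ≠ 0 → p ≤ x ∧ x ≤ q) ∧ ∀ x, |e x| ≤ K / R := by
  obtain ⟨K, hK0, hK⟩ := exists_abs_deriv_smoothTransition_le
  refine ⟨K, hK0, fun R hR => ?_⟩
  have hd : 0 < q - p := sub_pos.2 hpq
  set S := Real.smoothTransition with hS
  have hSs : ContDiff ℝ ∞ S := Real.smoothTransition.contDiff
  have hSd : ∀ x, HasDerivAt S (deriv S x) x := fun x =>
    (hSs.differentiable (by simp)).differentiableAt.hasDerivAt
  have hS0 : ∀ x, 0 ≤ S x := Real.smoothTransition.nonneg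
  have hS1 : ∀ x, S x ≤ 1 := Real.smoothTransition.le_one
  have hSm : ∀ x, 0 ≤ deriv S x := fun x => Real.smoothTransition.monotone.deriv_nonneg
  -- The first factor falls on `[p, q]` and yields `m`; the second rises on `[-2R, -R]` and yields
  -- `e`, of size `O(1 / R)`.
  refine ⟨fun x => S ((q - x) / (q - p)) * S (x / R + 2),
    fun x => deriv S ((q - x) / (q - p)) / (q - p) * S (x / R + 2),
    fun x => S ((q - x) / (q - p)) * (deriv S (x / R + 2) / R), ?_, ?_, ?_, ?_, ?_, ?_, ?_, ?_,
    ?_, ?_⟩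
  · exact (hSs.comp ((contDiff_const.sub contDiff_id).div_const _)).mul
      (hSs.comp ((contDiff_id.div_const _).add contDiff_const))
  · refine HasCompactSupport.intro (isCompact_Icc (a := -(2 * R)) (b := q)) fun x hx => ?_
    rw [mem_Icc, not_and_or, not_le, not_le] at hx
    rcases hx with h | h
    · have h1 : x / R + 2 ≤ 0 := by
        have : x / R ≤ -2 := by rw [div_le_iff₀ hR]; linarith
        linarith
      simp only [hS, Real.smoothTransition.zero_of_nonpos h1, mul_zero]
    · have h1 : (q - x) / (q - p) ≤ 0 := div_nonpos_of_nonpos_of_nonneg (by linarith) hd.le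
      simp only [hS, Real.smoothTransition.zero_of_nonpos h1, zero_mul]
  · exact fun x => mul_nonneg (hS0 _) (hS0 _)
  · exact fun x => mul_le_one₀ (hS1 _) (hS0 _) (hS1 _)
  · intro x h1 h2
    have h3 : 1 ≤ (q - x) / (q - p) := by rw [le_div_iff₀ hd]; linarith
    have h4 : 1 ≤ x / R + 2 := by
      have : -1 ≤ x / R := by rw [le_div_iff₀ hR]; linarith
      linarith
    simp only [hS, Real.smoothTransition.one_of_one_le h3, Real.smoothTransition.one_of_one_le h4,
      mul_one]
  · intro x h
    have h1 : (q - x) / (q - p) ≤ 0 := div_nonpos_of_nonpos_of_nonneg (by linarith) hd.le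
    simp only [hS, Real.smoothTransition.zero_of_nonpos h1, zero_mul]
  · intro x
    have h1 : HasDerivAt (fun x : ℝ => (q - x) / (q - p)) (-1 / (q - p)) x :=
      ((hasDerivAt_id x).const_sub q).div_const _
    have h2 : HasDerivAt (fun x : ℝ => x / R + 2) (1 / R) x :=
      ((hasDerivAt_id x).div_const R).add_const 2
    refine Eq.trans (((hSd _).comp x h1).mul ((hSd _).comp x h2)).deriv ?_
    simp only [Function.comp]
    ring
  · exact fun x => mul_nonneg (div_nonneg (hSm _) hd.le) (hS0 _)
  · intro x hx
    by_contra hcon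
    apply hx
    have hz : deriv S ((q - x) / (q - p)) = 0 := by
      rw [not_and_or, not_le, not_le] at hcon
      rcases hcon with h | h
      · have h1 : 1 < (q - x) / (q - p) := by rw [lt_div_iff₀ hd]; linarith
        have : S =ᶠ[𝓝 ((q - x) / (q - p))] fun _ => 1 := by
          filter_upwards [Ioi_mem_nhds h1] with z hz
          exact Real.smoothTransition.one_of_one_le (le_of_lt hz)
        rw [this.deriv_eq, deriv_const]
      · have h1 : (q - x) / (q - p) < 0 := div_neg_of_neg_of_pos (by linarith) hd
        have : S =ᶠ[𝓝 ((q - x) / (q - p))] fun _ => 0 := by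
          filter_upwards [Iio_mem_nhds h1] with z hz
          exact Real.smoothTransition.zero_of_nonpos (le_of_lt hz)
        rw [this.deriv_eq, deriv_const]
    simp only [hz, zero_div, zero_mul]
  · intro x
    rw [abs_mul, abs_div, abs_of_pos hR, abs_of_nonneg (hS0 _)]
    calc S ((q - x) / (q - p)) * (|deriv S (x / R + 2)| / R)
        ≤ 1 * (K / R) := by
          gcongr
          · exact hS1 _
          · exact hK _
      _ = K / R := one_mul _

theorem exists_bound_Icc {f : ℝ → ℝ} (hf : Continuous f) (a b : ℝ) :
    ∃ C, 0 ≤ C ∧ ∀ t ∈ Icc a b, f t ≤ C := by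
  obtain ⟨C, hC⟩ := isCompact_Icc.exists_bound_of_continuousOn (hf.continuousOn (s := Icc a b))
  exact ⟨max C 0, le_max_right _ _, fun t ht =>
    (le_abs_self _).trans ((hC t ht).trans (le_max_left _ _))⟩

namespace IsConservativeSolution

variable {u₀ : ℝ →ᵇ ℝ} {μ₀ : FiniteMeasure ℝ} {v : ℝ → (ℝ →ᵇ ℝ)} {ν : ℝ → FiniteMeasure ℝ}

theorem continuous_flux (hv : IsConservativeSolution u₀ μ₀ v ν) {ρ : ℝ → ℝ} (hρ : Continuous ρ)
    (hρc : HasCompactSupport ρ) (c : ℝ) :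
    Continuous fun t => ∫ x, ρ (x - c * t) * (v t x - c) ∂(ν t : Measure ℝ) :=
  continuous_integral_bcf (f := fun t =>
      shift (bcfOfCompact ρ hρ hρc) c t * (v t - BoundedContinuousFunction.const ℝ c))
    ((continuous_shift (uniformContinuous_bcfOfCompact _ _ _) c).mul
      (hv.continuous_u.sub continuous_const)) hv.continuous_μ

theorem integrable_flux {ρ : ℝ → ℝ} (hρ : Continuous ρ) (hρc : HasCompactSupport ρ) (c t : ℝ) :
    Integrable (fun x => ρ (x - c * t) * (v t x - c)) (ν t : Measure ℝ) :=
  integrable_bcf (ν t)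
    (shift (bcfOfCompact ρ hρ hρc) c t * (v t - BoundedContinuousFunction.const ℝ c))

theorem integrable_shift {ρ : ℝ → ℝ} (hρ : Continuous ρ) (hρc : HasCompactSupport ρ) (c t : ℝ) :
    Integrable (fun x => ρ (x - c * t)) (ν t : Measure ℝ) :=
  integrable_bcf (ν t) (shift (bcfOfCompact ρ hρ hρc) c t)

theorem integral_cutoff_le {ρ : ℝ → ℝ} {q : ℝ} (hρ : Continuous ρ) (hρc : HasCompactSupport ρ)
    (h1 : ∀ x, ρ x ≤ 1) (hq : ∀ x, q < x → ρ x = 0) (c t : ℝ) :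
    ∫ x, ρ (x - c * t) ∂(ν t : Measure ℝ) ≤ (ν t : Measure ℝ).real (Iic (q + c * t)) := by
  rw [← integral_indicator_one measurableSet_Iic]
  refine integral_mono (integrable_shift hρ hρc c t)
    ((integrable_const (1 : ℝ)).indicator measurableSet_Iic) fun x => ?_
  by_cases hx : x ∈ Iic (q + c * t)
  · rw [indicator_of_mem hx]
    exact h1 _
  · rw [indicator_of_notMem hx, hq _ (by rw [mem_Iic, not_le] at hx; linarith)]

theorem le_integral_cutoff {ρ : ℝ → ℝ} {p R : ℝ} (hρ : Continuous ρ) (hρc : HasCompactSupport ρ)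
    (h0 : ∀ x, 0 ≤ ρ x) (hp : ∀ x, -R < x → x ≤ p → ρ x = 1) (c t : ℝ) :
    (ν t : Measure ℝ).real (Iic (p + c * t)) - (ν t : Measure ℝ).real (Iic (-R + c * t)) ≤
      ∫ x, ρ (x - c * t) ∂(ν t : Measure ℝ) := by
  have i1 : ∀ y, Integrable ((Iic y).indicator (1 : ℝ → ℝ)) (ν t : Measure ℝ) := fun y =>
    (integrable_const (1 : ℝ)).indicator measurableSet_Iic
  rw [← integral_indicator_one measurableSet_Iic, ← integral_indicator_one measurableSet_Iic,
    ← integral_sub (i1 _) (i1 _)]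
  refine integral_mono ((i1 _).sub (i1 _)) (integrable_shift hρ hρc c t) fun x => ?_
  simp only [indicator_apply, mem_Iic, Pi.one_apply]
  have hx0 := h0 (x - c * t)
  split_ifs with h1 h2 h2
  · simpa using hx0
  · rw [hp _ (by linarith) (by linarith)]
    simp
  · linarith
  · simpa using hx0

/-- Lets the left end of the cutoff go to `-∞`: both the energy beyond `-R + s` and the flux error
`C / R` vanish. -/
theorem le_of_forall_error {A B C : ℝ} {m : Measure ℝ} [IsFiniteMeasure m] (s : ℝ)
    (h : ∀ R, 0 < R → A - m.real (Iic (-R + s)) ≤ B + C / R) : A ≤ B := by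
  have h1 : Tendsto (fun R : ℝ => A - m.real (Iic (-R + s))) atTop (𝓝 (A - 0)) :=
    tendsto_const_nhds.sub ((tendsto_real_Iic_atBot m).comp
      (tendsto_atBot_add_const_right _ _ tendsto_neg_atTop_atBot))
  have h2 : Tendsto (fun R : ℝ => B + C / R) atTop (𝓝 (B + 0)) :=
    tendsto_const_nhds.add (tendsto_const_nhds.div_atTop tendsto_id)
  rw [sub_zero] at h1
  rw [add_zero] at h2
  exact le_of_tendsto_of_tendsto h1 h2 ((eventually_gt_atTop 0).mono h)

theorem exists_flux_bounds (hv : IsConservativeSolution u₀ μ₀ v ν) (c t₁ t₂ : ℝ) :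
    ∃ C M, 0 ≤ C ∧ 0 ≤ M ∧ (∀ t ∈ Icc t₁ t₂, ∀ x, |v t x - c| ≤ C) ∧
      ∀ t ∈ Icc t₁ t₂, (ν t : Measure ℝ).real univ ≤ M := by
  obtain ⟨C, hC0, hC⟩ := exists_bound_Icc
    ((hv.continuous_u.sub (continuous_const (y := BoundedContinuousFunction.const ℝ c))).norm) t₁ t₂
  obtain ⟨M, hM0, hM⟩ := exists_bound_Icc (continuous_real_univ hv.continuous_μ) t₁ t₂
  exact ⟨C, M, hC0, hM0, fun t ht x =>
    ((v t - BoundedContinuousFunction.const ℝ c).norm_coe_le_norm x).trans (hC t ht), hM⟩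

/-- If the velocity does not exceed `c` in a window around a point moving with speed `c`, the energy
on the left of that point does not decrease. -/
theorem real_Iic_le_of_le_speed (hv : IsConservativeSolution u₀ μ₀ v ν) {c p q t₁ t₂ : ℝ}
    (hpq : p < q) (ht : t₁ ≤ t₂)
    (h : ∀ t ∈ Icc t₁ t₂, ∀ x, p + c * t ≤ x → x ≤ q + c * t → v t x ≤ c) :
    (ν t₁ : Measure ℝ).real (Iic (p + c * t₁)) ≤ (ν t₂ : Measure ℝ).real (Iic (q + c * t₂)) := by
  obtain ⟨K, hK0, hK⟩ := exists_cutoff hpq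
  obtain ⟨C, M, hC0, hM0, hC, hM⟩ := hv.exists_flux_bounds c t₁ t₂
  refine le_of_forall_error (C := K * C * M * (t₂ - t₁)) (m := (ν t₁ : Measure ℝ)) (c * t₁) fun R hR => ?_
  obtain ⟨ρ, m, e, hρ, hρc, h0, h1, hp, hq, hd, hm0, hm, he⟩ := hK R hR
  have hdc : Continuous (deriv ρ) := hρ.continuous_deriv (by simp)
  have a1 := integral_cutoff_le (ν := ν) hρ.continuous hρc h1 hq c t₂
  have a2 := le_integral_cutoff (ν := ν) hρ.continuous hρc h0 hp c t₁
  have a3 := hv.transport hρ hρc c t₁ t₂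
  -- With `ρ' = e - m`, the part `-m (v - c)` is nonnegative because `v ≤ c` on the window, and the
  -- part with `e` costs at most `K C / R` per unit of energy.
  have a4 : ∫ _t in t₁..t₂, -(K / R * C * M) ≤
      ∫ t in t₁..t₂, ∫ x, deriv ρ (x - c * t) * (v t x - c) ∂(ν t : Measure ℝ) := by
    refine intervalIntegral.integral_mono_on ht (by simp)
      ((hv.continuous_flux hdc hρc.deriv c).intervalIntegrable _ _) fun t htt => ?_
    have b1 : ∫ _x, -(K / R * C) ∂(ν t : Measure ℝ) ≤
        ∫ x, deriv ρ (x - c * t) * (v t x - c) ∂(ν t : Measure ℝ) := by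
      refine integral_mono (integrable_const _) (integrable_flux hdc hρc.deriv c t) fun x => ?_
      simp only [hd]
      have c1 : |e (x - c * t) * (v t x - c)| ≤ K / R * C := by
        rw [abs_mul]
        exact mul_le_mul (he _) (hC t htt x) (abs_nonneg _) (by positivity)
      have c2 : m (x - c * t) * (v t x - c) ≤ 0 := by
        by_cases hz : m (x - c * t) = 0
        · simp [hz]
        · obtain ⟨d1, d2⟩ := hm _ hz
          exact mul_nonpos_of_nonneg_of_nonpos (hm0 _)
            (sub_nonpos.2 (h t htt x (by linarith) (by linarith)))
      linarith [neg_abs_le (e (x - c * t) * (v t x - c))]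
    rw [integral_const, smul_eq_mul] at b1
    have b2 : K / R * C * (ν t : Measure ℝ).real univ ≤ K / R * C * M := by
      gcongr
      exact hM t htt
    linarith
  rw [intervalIntegral.integral_const, smul_eq_mul] at a4
  have a5 : K * C * M * (t₂ - t₁) / R = (t₂ - t₁) * (K / R * C * M) := by ring
  linarith

/-- If the velocity is at least `c` in a window around a point moving with speed `c`, the energy
on the left of that point does not increase. -/
theorem real_Iic_le_of_speed_le (hv : IsConservativeSolution u₀ μ₀ v ν) {c p q t₁ t₂ : ℝ}
    (hpq : p < q) (ht : t₁ ≤ t₂)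
    (h : ∀ t ∈ Icc t₁ t₂, ∀ x, p + c * t ≤ x → x ≤ q + c * t → c ≤ v t x) :
    (ν t₂ : Measure ℝ).real (Iic (p + c * t₂)) ≤ (ν t₁ : Measure ℝ).real (Iic (q + c * t₁)) := by
  obtain ⟨K, hK0, hK⟩ := exists_cutoff hpq
  obtain ⟨C, M, hC0, hM0, hC, hM⟩ := hv.exists_flux_bounds c t₁ t₂
  refine le_of_forall_error (C := K * C * M * (t₂ - t₁)) (m := (ν t₂ : Measure ℝ)) (c * t₂) fun R hR => ?_
  obtain ⟨ρ, m, e, hρ, hρc, h0, h1, hp, hq, hd, hm0, hm, he⟩ := hK R hR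
  have hdc : Continuous (deriv ρ) := hρ.continuous_deriv (by simp)
  have a1 := integral_cutoff_le (ν := ν) hρ.continuous hρc h1 hq c t₁
  have a2 := le_integral_cutoff (ν := ν) hρ.continuous hρc h0 hp c t₂
  have a3 := hv.transport hρ hρc c t₁ t₂
  -- Now `v ≥ c` on the window, so `-m (v - c)` is nonpositive.
  have a4 : ∫ t in t₁..t₂, ∫ x, deriv ρ (x - c * t) * (v t x - c) ∂(ν t : Measure ℝ) ≤
      ∫ _t in t₁..t₂, K / R * C * M := by
    refine intervalIntegral.integral_mono_on ht
      ((hv.continuous_flux hdc hρc.deriv c).intervalIntegrable _ _) (by simp) fun t htt => ?_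
    have b1 : ∫ x, deriv ρ (x - c * t) * (v t x - c) ∂(ν t : Measure ℝ) ≤
        ∫ _x, K / R * C ∂(ν t : Measure ℝ) := by
      refine integral_mono (integrable_flux hdc hρc.deriv c t) (integrable_const _) fun x => ?_
      simp only [hd]
      have c1 : |e (x - c * t) * (v t x - c)| ≤ K / R * C := by
        rw [abs_mul]
        exact mul_le_mul (he _) (hC t htt x) (abs_nonneg _) (by positivity)
      have c2 : 0 ≤ m (x - c * t) * (v t x - c) := by
        by_cases hz : m (x - c * t) = 0
        · simp [hz]
        · obtain ⟨d1, d2⟩ := hm _ hz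
          exact mul_nonneg (hm0 _) (sub_nonneg.2 (h t htt x (by linarith) (by linarith)))
      linarith [le_abs_self (e (x - c * t) * (v t x - c))]
    rw [integral_const, smul_eq_mul] at b1
    have b2 : K / R * C * (ν t : Measure ℝ).real univ ≤ K / R * C * M := by
      gcongr
      exact hM t htt
    linarith
  rw [intervalIntegral.integral_const, smul_eq_mul] at a4
  have a5 : K * C * M * (t₂ - t₁) / R = (t₂ - t₁) * (K / R * C * M) := by ring
  linarith

/-- Energy propagates with bounded speed. -/
theorem exists_shift_real_Iic_le (hv : IsConservativeSolution u₀ μ₀ v ν) (s t : ℝ) :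
    ∃ d, ∀ x, (ν s : Measure ℝ).real (Iic x) ≤ (ν t : Measure ℝ).real (Iic (x + d)) := by
  -- A window of width `1` moving with the extreme speed `±C` satisfies the sign condition
  -- everywhere.
  obtain ⟨C, M, hC0, -, hC, -⟩ := hv.exists_flux_bounds 0 (min s t) (max s t)
  rcases le_total s t with hst | hst
  · rw [min_eq_left hst, max_eq_right hst] at hC
    refine ⟨1 + C * (t - s), fun x => ?_⟩
    have := hv.real_Iic_le_of_le_speed (c := C) (p := x - C * s) (q := x - C * s + 1)
      (by linarith) hst fun r hr z _ _ => by
        have := (abs_le.1 (hC r hr z)).2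
        linarith
    convert this using 3 <;> ring
  · rw [min_eq_right hst, max_eq_left hst] at hC
    refine ⟨1 + C * (s - t), fun x => ?_⟩
    have := hv.real_Iic_le_of_speed_le (c := -C) (p := x + C * s) (q := x + C * s + 1)
      (by linarith) hst fun r hr z _ _ => by
        have := (abs_le.1 (hC r hr z)).1
        linarith
    convert this using 3 <;> ring

/-- The total energy is conserved. -/
theorem real_univ_eq (hv : IsConservativeSolution u₀ μ₀ v ν) (s t : ℝ) :
    (ν s : Measure ℝ).real univ = (ν t : Measure ℝ).real univ := by
  have key : ∀ s t, (ν s : Measure ℝ).real univ ≤ (ν t : Measure ℝ).real univ := by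
    intro s t
    obtain ⟨d, hd⟩ := hv.exists_shift_real_Iic_le s t
    exact le_of_tendsto' (tendsto_real_Iic_atTop _) fun x =>
      (hd x).trans (measureReal_mono (subset_univ _))
  exact le_antisymm (key s t) (key t s)

end IsConservativeSolution

/-! ### Quantiles of the energy are characteristics -/

/-- The left quantile of level `a` of a measure on the line. -/
def quantile (m : Measure ℝ) (a : ℝ) : ℝ := sInf {x | a ≤ m.real (Iic x)}

section Quantile

variable {m : Measure ℝ} [IsFiniteMeasure m] {a : ℝ}

theorem bddBelow_quantile_set (ha : 0 < a) : BddBelow {x | a ≤ m.real (Iic x)} := by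
  obtain ⟨b, hb⟩ := ((tendsto_real_Iic_atBot m).eventually (gt_mem_nhds ha)).exists
  refine ⟨b, fun x hx => ?_⟩
  by_contra hcon
  have h1 : a ≤ m.real (Iic x) := hx
  linarith [real_Iic_mono m (not_le.1 hcon).le]

theorem quantile_le (ha : 0 < a) {x : ℝ} (hx : a ≤ m.real (Iic x)) : quantile m a ≤ x :=
  csInf_le (bddBelow_quantile_set ha) hx

theorem real_Iic_lt_of_lt_quantile (ha : 0 < a) {x : ℝ} (hx : x < quantile m a) :
    m.real (Iic x) < a := by
  by_contra hcon
  exact absurd (quantile_le ha (not_lt.1 hcon)) (not_le.2 hx)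

theorem le_real_Iic_quantile (hne : ∃ x, a ≤ m.real (Iic x)) :
    a ≤ m.real (Iic (quantile m a)) := by
  refine le_real_Iic_of_forall_gt m fun z hz => ?_
  obtain ⟨x, hx, hxz⟩ := exists_lt_of_csInf_lt (s := {x | a ≤ m.real (Iic x)}) hne hz
  exact le_trans hx (real_Iic_mono m hxz.le)

theorem le_quantile_of_lt (hne : ∃ x, a ≤ m.real (Iic x)) {x : ℝ} (hx : m.real (Iic x) < a) :
    x ≤ quantile m a := by
  by_contra hcon
  linarith [real_Iic_mono m (not_le.1 hcon).le, le_real_Iic_quantile hne]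

theorem real_Iio_quantile_le (ha : 0 < a) : m.real (Iio (quantile m a)) ≤ a :=
  real_Iio_le_of_forall_lt m fun _ hz => (real_Iic_lt_of_lt_quantile ha hz).le

end Quantile

namespace IsConservativeSolution

variable {u₀ : ℝ →ᵇ ℝ} {μ₀ : FiniteMeasure ℝ} {v : ℝ → (ℝ →ᵇ ℝ)} {ν : ℝ → FiniteMeasure ℝ}

theorem continuous_uncurry (hv : IsConservativeSolution u₀ μ₀ v ν) :
    Continuous fun p : ℝ × ℝ => v p.1 p.2 :=
  continuous_eval.comp ((hv.continuous_u.comp continuous_fst).prodMk continuous_snd)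

/-- Bounded propagation speed carries attainment of a level to all times. Without it the quantile
could be the infimum of an empty set, with the default value `0`. -/
theorem exists_le_real_Iic (hv : IsConservativeSolution u₀ μ₀ v ν) {a : ℝ} {s : ℝ}
    (hne : ∃ x, a ≤ (ν s : Measure ℝ).real (Iic x)) (t : ℝ) :
    ∃ x, a ≤ (ν t : Measure ℝ).real (Iic x) := by
  obtain ⟨x, hx⟩ := hne
  obtain ⟨d, hd⟩ := hv.exists_shift_real_Iic_le s t
  exact ⟨x + d, hx.trans (hd x)⟩

/-- Near `(s, x₀)` the velocity is within `δ` of `v₀`, so the lines through `x₀` with speeds `v₀ ±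
δ` are barriers which the level `a` cannot cross. This confines the difference quotient to `[v₀ - δ,
v₀ + δ]`. -/
theorem hasDerivAt_quantile (hv : IsConservativeSolution u₀ μ₀ v ν) {a : ℝ} (ha : 0 < a)
    (hne : ∃ x, a ≤ (ν 0 : Measure ℝ).real (Iic x)) (s : ℝ) :
    HasDerivAt (fun t => quantile (ν t) a) (v s (quantile (ν s) a)) s := by
  have hne' := hv.exists_le_real_Iic hne
  set x₀ := quantile (ν s) a with hx₀
  set v₀ := v s x₀ with hv₀
  rw [hasDerivAt_iff_isLittleO, Asymptotics.isLittleO_iff]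
  intro δ hδ
  obtain ⟨r, hr, hball⟩ := Metric.continuous_iff.1 hv.continuous_uncurry (s, x₀) δ hδ
  have hloc : ∀ t x, |t - s| < r → |x - x₀| < r → |v t x - v₀| < δ := by
    intro t x ht hx
    exact hball (t, x) (by
      rw [Prod.dist_eq, Real.dist_eq, Real.dist_eq]
      exact max_lt ht hx)
  -- `L` bounds both barrier speeds. The time radius keeps the drift below `r / 2` and the windows
  -- add at most `2η ≤ r / 4`, so everything stays within distance `r` of `x₀`.
  set L := |v₀| + δ with hL
  have hL0 : 0 < L := by positivity
  have hr' : 0 < min r (r / (2 * L)) := lt_min hr (by positivity)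
  filter_upwards [Metric.ball_mem_nhds s hr'] with t ht
  rw [Metric.mem_ball, Real.dist_eq, lt_min_iff, lt_div_iff₀ (by positivity)] at ht
  have hwin : ∀ c, |c| ≤ L → ∀ η, 0 < η → η ≤ r / 8 → ∀ τ, |τ - s| ≤ |t - s| → ∀ x,
      x₀ - 2 * η + c * (τ - s) ≤ x → x ≤ x₀ + 2 * η + c * (τ - s) → |v τ x - v₀| < δ := by
    intro c hc η hη hηr τ hτ x h1 h2
    refine hloc τ x (hτ.trans_lt ht.1) ?_
    have h3 : |c * (τ - s)| ≤ |t - s| * L := by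
      rw [abs_mul, mul_comm]
      exact mul_le_mul hτ hc (abs_nonneg _) (abs_nonneg _)
    obtain ⟨h4, h5⟩ := abs_le.1 h3
    rw [abs_lt]
    constructor <;> linarith
  have hc1 : |v₀ + δ| ≤ L := (abs_add_le _ _).trans (by rw [abs_of_pos hδ])
  have hc2 : |v₀ - δ| ≤ L := (abs_sub _ _).trans (by rw [abs_of_pos hδ])
  have hsq : a ≤ (ν s : Measure ℝ).real (Iic x₀) := le_real_Iic_quantile (hne' s)
  have hlt : ∀ η, 0 < η → (ν s : Measure ℝ).real (Iic (x₀ - η)) < a := fun η hη =>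
    real_Iic_lt_of_lt_quantile ha (by linarith)
  rw [smul_eq_mul, Real.norm_eq_abs, Real.norm_eq_abs]
  rcases le_total s t with hst | hst
  · have hτ : ∀ τ ∈ Icc s t, |τ - s| ≤ |t - s| := fun τ h => by
      rw [abs_of_nonneg (by linarith [h.1]), abs_of_nonneg (by linarith)]
      linarith [h.2]
    have up : quantile (ν t) a ≤ x₀ + (v₀ + δ) * (t - s) := by
      refine le_of_forall_pos_le_add fun ε hε => ?_
      set η := min ε (r / 8)
      have hη : 0 < η := lt_min hε (by positivity)
      have key := hv.real_Iic_le_of_le_speed (c := v₀ + δ) (p := x₀ - (v₀ + δ) * s)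
        (q := x₀ - (v₀ + δ) * s + η) (by linarith) hst fun τ hτ' x h1 h2 => by
          have := hwin _ hc1 η hη (min_le_right _ _) τ (hτ τ hτ') x (by linarith) (by linarith)
          linarith [(abs_lt.1 this).2]
      refine (quantile_le ha (hsq.trans ((real_Iic_mono _ (by linarith)).trans key))).trans ?_
      linarith [min_le_left ε (r / 8)]
    -- The window starts at `[x₀ - 2η, x₀ - η]`, strictly left of the quantile, where the energy is
    -- strictly below `a`.
    have lo : x₀ + (v₀ - δ) * (t - s) ≤ quantile (ν t) a := by
      refine le_of_forall_pos_le_add fun ε hε => ?_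
      set η := min (ε / 2) (r / 8)
      have hη : 0 < η := lt_min (by positivity) (by positivity)
      have key := hv.real_Iic_le_of_speed_le (c := v₀ - δ) (p := x₀ - (v₀ - δ) * s - 2 * η)
        (q := x₀ - (v₀ - δ) * s - η) (by linarith) hst fun τ hτ' x h1 h2 => by
          have := hwin _ hc2 η hη (min_le_right _ _) τ (hτ τ hτ') x (by linarith) (by linarith)
          linarith [(abs_lt.1 this).1]
      have h3 := le_quantile_of_lt (hne' t) (lt_of_le_of_lt (key.trans
        (real_Iic_mono _ (show _ ≤ x₀ - η by linarith))) (hlt η hη))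
      linarith [min_le_left (ε / 2) (r / 8)]
    rw [abs_of_nonneg (sub_nonneg.2 hst), abs_le]
    constructor <;> linarith
  -- Backwards in time the two barrier speeds exchange their roles.
  · have hτ : ∀ τ ∈ Icc t s, |τ - s| ≤ |t - s| := fun τ h => by
      rw [abs_of_nonpos (by linarith [h.2]), abs_of_nonpos (by linarith)]
      linarith [h.1]
    have up : quantile (ν t) a ≤ x₀ + (v₀ - δ) * (t - s) := by
      refine le_of_forall_pos_le_add fun ε hε => ?_
      set η := min ε (r / 8)
      have hη : 0 < η := lt_min hε (by positivity)
      have key := hv.real_Iic_le_of_speed_le (c := v₀ - δ) (p := x₀ - (v₀ - δ) * s)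
        (q := x₀ - (v₀ - δ) * s + η) (by linarith) hst fun τ hτ' x h1 h2 => by
          have := hwin _ hc2 η hη (min_le_right _ _) τ (hτ τ hτ') x (by linarith) (by linarith)
          linarith [(abs_lt.1 this).1]
      refine (quantile_le ha (hsq.trans ((real_Iic_mono _ (by linarith)).trans key))).trans ?_
      linarith [min_le_left ε (r / 8)]
    have lo : x₀ + (v₀ + δ) * (t - s) ≤ quantile (ν t) a := by
      refine le_of_forall_pos_le_add fun ε hε => ?_
      set η := min (ε / 2) (r / 8)
      have hη : 0 < η := lt_min (by positivity) (by positivity)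
      have key := hv.real_Iic_le_of_le_speed (c := v₀ + δ) (p := x₀ - (v₀ + δ) * s - 2 * η)
        (q := x₀ - (v₀ + δ) * s - η) (by linarith) hst fun τ hτ' x h1 h2 => by
          have := hwin _ hc1 η hη (min_le_right _ _) τ (hτ τ hτ') x (by linarith) (by linarith)
          linarith [(abs_lt.1 this).2]
      have h3 := le_quantile_of_lt (hne' t) (lt_of_le_of_lt (key.trans
        (real_Iic_mono _ (show _ ≤ x₀ - η by linarith))) (hlt η hη))
      linarith [min_le_left (ε / 2) (r / 8)]
    rw [abs_of_nonpos (sub_nonpos.2 hst), abs_le]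
    constructor <;> linarith

end IsConservativeSolution

/-! ### The increment bound and the potential of the energy -/

/-- Cauchy-Schwarz, by expanding `∫ (g - l)² ≥ 0` with `l` the mean of `g`. -/
theorem sq_integral_le {g : ℝ → ℝ} (hg : MemLp g 2 volume) {p q : ℝ} (hpq : p ≤ q) :
    (∫ x in p..q, g x) ^ 2 ≤ (q - p) * ∫ x in p..q, g x ^ 2 := by
  rcases hpq.eq_or_lt with rfl | hlt
  · simp
  have hd : 0 < q - p := sub_pos.2 hlt
  have i2 : IntervalIntegrable (fun x => g x ^ 2) volume p q := hg.integrable_sq.intervalIntegrable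
  have i1 : IntervalIntegrable g volume p q :=
    intervalIntegrable_of_locallyIntegrable (hg.locallyIntegrable (by norm_num)) p q
  set D := ∫ x in p..q, g x with hD
  set l := D / (q - p) with hl
  have h1 : 0 ≤ ∫ x in p..q, (g x - l) ^ 2 :=
    intervalIntegral.integral_nonneg hpq fun x _ => sq_nonneg _
  have h2 : ∫ x in p..q, (g x - l) ^ 2 =
      (∫ x in p..q, g x ^ 2) - 2 * l * D + (q - p) * l ^ 2 := by
    have e : ∀ x, (g x - l) ^ 2 = g x ^ 2 - 2 * l * g x + l ^ 2 := fun x => by ring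
    simp_rw [e]
    rw [intervalIntegral.integral_add (i2.sub (i1.const_mul _)) intervalIntegrable_const,
      intervalIntegral.integral_sub i2 (i1.const_mul _), intervalIntegral.integral_const_mul,
      intervalIntegral.integral_const, smul_eq_mul]
  rw [h2] at h1
  have h3 : D = l * (q - p) := by rw [hl]; field_simp
  rw [h3] at h1 ⊢
  nlinarith

namespace IsConservativeSolution

variable {u₀ : ℝ →ᵇ ℝ} {μ₀ : FiniteMeasure ℝ} {v : ℝ → (ℝ →ᵇ ℝ)} {ν : ℝ → FiniteMeasure ℝ}

/-- Cauchy-Schwarz with `u_x² dx = dν_ac ≤ dν`, which holds at every time, including those with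
singular energy. Endpoints are Lebesgue null, so atoms there do not count. -/
theorem sq_sub_le (hv : IsConservativeSolution u₀ μ₀ v ν) (t : ℝ) {p q : ℝ} (hpq : p ≤ q) :
    (v t q - v t p) ^ 2 ≤ (q - p) * (ν t : Measure ℝ).real (Ioo p q) := by
  obtain ⟨ux, hux, -, -, hac⟩ := hv.exists_ux
  obtain ⟨hw, hL⟩ := hux t
  rw [hw.sub_eq_integral (v t).continuous p q]
  refine (sq_integral_le hL hpq).trans (mul_le_mul_of_nonneg_left ?_ (sub_nonneg.2 hpq))
  have h1 : volume.withDensity (fun x => ENNReal.ofReal (ux t x ^ 2)) (Ioo p q) ≤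
      (ν t : Measure ℝ) (Ioo p q) := by
    rw [← hac t]
    exact Measure.withDensity_rnDeriv_le _ _ _
  rw [withDensity_apply _ measurableSet_Ioo] at h1
  rw [intervalIntegral.integral_of_le hpq, integral_Ioc_eq_integral_Ioo,
    integral_eq_lintegral_of_nonneg_ae (ae_of_all _ fun x => sq_nonneg _)
      hL.integrable_sq.aestronglyMeasurable.restrict]
  exact ENNReal.toReal_mono (measure_ne_top _ _) h1

theorem sq_sub_le_real_Iio (hv : IsConservativeSolution u₀ μ₀ v ν) (t : ℝ) {p q : ℝ}
    (hpq : p ≤ q) : (v t q - v t p) ^ 2 ≤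
      (q - p) * ((ν t : Measure ℝ).real (Iio q) - (ν t : Measure ℝ).real (Iic p)) := by
  rcases hpq.eq_or_lt with rfl | hlt
  · simp
  refine (hv.sq_sub_le t hpq).trans_eq ?_
  have h1 : Iic p ⊆ Iio q := fun z hz => lt_of_le_of_lt hz hlt
  have h2 : Iio q \ Iic p = Ioo p q := by
    ext z
    simp
  rw [← measureReal_sdiff h1 measurableSet_Iic, h2]

/-- For a.e. time the energy is absolutely continuous, hence has no atoms; the exceptional set of
times does not depend on `x`. -/
theorem ae_real_Iio_eq (hv : IsConservativeSolution u₀ μ₀ v ν) :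
    ∀ᵐ t, ∀ x, (ν t : Measure ℝ).real (Iio x) = (ν t : Measure ℝ).real (Iic x) := by
  obtain ⟨ux, -, hae, -, -⟩ := hv.exists_ux
  filter_upwards [hae] with t ht x
  rw [measureReal_def, measureReal_def, ht, measure_congr]
  exact (withDensity_absolutelyContinuous _ _).ae_le Iio_ae_eq_Iic

end IsConservativeSolution

/-- The kernel `ζ ↦ ∫₀ˣ 1_{ζ < z} dz`. -/
def potentialKernel (x : ℝ) : ℝ →ᵇ ℝ :=
  BoundedContinuousFunction.ofNormedAddCommGroup (fun ζ => max (x - ζ) 0 - max (0 - ζ) 0)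
    (by fun_prop) |x| fun ζ => by
      have := abs_max_sub_max_le_abs (x - ζ) (0 - ζ) 0
      rw [sub_sub_sub_cancel_right, sub_zero] at this
      exact this

theorem potentialKernel_apply (x ζ : ℝ) :
    potentialKernel x ζ = max (x - ζ) 0 - max (0 - ζ) 0 := rfl

theorem continuous_potentialKernel : Continuous potentialKernel := by
  refine (LipschitzWith.of_dist_le_mul (K := 1) fun x y => ?_).continuous
  rw [NNReal.coe_one, one_mul]
  refine (BoundedContinuousFunction.dist_le dist_nonneg).2 fun ζ => ?_
  rw [Real.dist_eq, Real.dist_eq, potentialKernel_apply, potentialKernel_apply,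
    sub_sub_sub_cancel_right]
  refine (abs_max_sub_max_le_abs _ _ _).trans_eq ?_
  rw [sub_sub_sub_cancel_right]

/-- The primitive `∫₀ˣ m((-∞, z]) dz` of the distribution function. -/
def potential (m : FiniteMeasure ℝ) (x : ℝ) : ℝ := ∫ ζ, potentialKernel x ζ ∂(m : Measure ℝ)

/-- The increment of the kernel lies between `(y - x) 1_{ζ ≤ x}` and `(y - x) 1_{ζ ≤ y}`; the next
lemma uses the upper half. -/
theorem mul_real_Iic_le_potential_sub (m : FiniteMeasure ℝ) {x y : ℝ} (h : x ≤ y) :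
    (y - x) * (m : Measure ℝ).real (Iic x) ≤ potential m y - potential m x := by
  rw [potential, potential, ← integral_sub (integrable_bcf _ _) (integrable_bcf _ _), mul_comm,
    ← smul_eq_mul, ← integral_indicator_const _ measurableSet_Iic]
  refine integral_mono ((integrable_const _).indicator measurableSet_Iic)
    ((integrable_bcf _ _).sub (integrable_bcf _ _)) fun ζ => ?_
  simp only [indicator_apply, mem_Iic, potentialKernel_apply]
  split_ifs with hζ
  · rw [max_eq_left (by linarith : 0 ≤ y - ζ), max_eq_left (by linarith : 0 ≤ x - ζ)]
    linarith
  · linarith [max_le_max (by linarith : x - ζ ≤ y - ζ) (le_refl (0 : ℝ))]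

theorem potential_sub_le_mul_real_Iic (m : FiniteMeasure ℝ) {x y : ℝ} (h : x ≤ y) :
    potential m y - potential m x ≤ (y - x) * (m : Measure ℝ).real (Iic y) := by
  rw [potential, potential, ← integral_sub (integrable_bcf _ _) (integrable_bcf _ _), mul_comm,
    ← smul_eq_mul, ← integral_indicator_const _ measurableSet_Iic]
  refine integral_mono ((integrable_bcf _ _).sub (integrable_bcf _ _))
    ((integrable_const _).indicator measurableSet_Iic) fun ζ => ?_
  simp only [indicator_apply, mem_Iic, potentialKernel_apply]
  split_ifs with hζ
  · rw [max_eq_left (by linarith : 0 ≤ y - ζ)]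
    linarith [le_max_left (x - ζ) 0]
  · rw [max_eq_right (by linarith : y - ζ ≤ 0), max_eq_right (by linarith : x - ζ ≤ 0)]
    linarith

theorem lipschitzWith_potential (m : FiniteMeasure ℝ) :
    LipschitzWith m.mass (potential m) := by
  have key : ∀ x y, x ≤ y → |potential m x - potential m y| ≤ m.mass * |x - y| := by
    intro x y h
    have h1 := mul_real_Iic_le_potential_sub m h
    have h2 := potential_sub_le_mul_real_Iic m h
    have h3 : 0 ≤ (y - x) * (m : Measure ℝ).real (Iic x) :=
      mul_nonneg (sub_nonneg.2 h) measureReal_nonneg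
    have h4 : (y - x) * (m : Measure ℝ).real (Iic y) ≤ (y - x) * (m.mass : ℝ) :=
      mul_le_mul_of_nonneg_left (measureReal_mono (subset_univ _)) (sub_nonneg.2 h)
    rw [abs_of_nonpos (by linarith), abs_of_nonpos (by linarith)]
    linarith
  refine LipschitzWith.of_dist_le_mul fun x y => ?_
  rw [Real.dist_eq, Real.dist_eq]
  rcases le_total x y with h | h
  · exact key x y h
  · rw [abs_sub_comm, abs_sub_comm x y]
    exact key y x h

theorem tendsto_const_add_nhdsGT_zero (x : ℝ) :
    Tendsto (fun ε : ℝ => x + ε) (𝓝[>] 0) (𝓝[>] x) := by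
  refine tendsto_nhdsWithin_iff.2 ⟨?_, ?_⟩
  · have : Tendsto (fun ε : ℝ => x + ε) (𝓝 0) (𝓝 (x + 0)) := tendsto_const_nhds.add tendsto_id
    rw [add_zero] at this
    exact this.mono_left nhdsWithin_le_nhds
  · filter_upwards [self_mem_nhdsWithin] with ε hε
    exact lt_add_of_pos_right x hε

/-- Right slopes are squeezed between values of a right-continuous distribution function, so the
limit exists even at atoms. -/
theorem tendsto_potential_slope (m : FiniteMeasure ℝ) (x : ℝ) :
    Tendsto (fun ε => ε⁻¹ * (potential m (x + ε) - potential m x)) (𝓝[>] 0)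
      (𝓝 ((m : Measure ℝ).real (Iic x))) := by
  have h1 := tendsto_const_add_nhdsGT_zero x
  refine tendsto_of_tendsto_of_tendsto_of_le_of_le' tendsto_const_nhds
    ((tendsto_real_Iic_nhdsGT (m : Measure ℝ) x).comp h1) ?_ ?_
  · filter_upwards [self_mem_nhdsWithin] with ε (hε : 0 < ε)
    have := mul_real_Iic_le_potential_sub m (le_add_of_nonneg_right hε.le : x ≤ x + ε)
    rw [le_inv_mul_iff₀ hε]
    linarith
  · filter_upwards [self_mem_nhdsWithin] with ε (hε : 0 < ε)
    have := potential_sub_le_mul_real_Iic m (le_add_of_nonneg_right hε.le : x ≤ x + ε)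
    rw [inv_mul_le_iff₀ hε]
    simp only [Function.comp]
    linarith

theorem ae_hasDerivAt_potential (m : FiniteMeasure ℝ) :
    ∀ᵐ x, HasDerivAt (potential m) ((m : Measure ℝ).real (Iic x)) x := by
  filter_upwards [(lipschitzWith_potential m).ae_differentiableAt] with x hx
  have h1 := hx.hasDerivAt.tendsto_slope_zero_right
  have h2 := tendsto_nhds_unique h1 (tendsto_potential_slope m x)
  rw [← h2]
  exact hx.hasDerivAt

/-- The distribution function may jump in `x` and in `t`. Its primitive is a pairing with a bounded
continuous kernel, hence jointly continuous, and so the momentum flux is continuous. -/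
theorem continuous_potential {ν : ℝ → FiniteMeasure ℝ} (hν : Continuous ν) :
    Continuous fun p : ℝ × ℝ => potential (ν p.1) p.2 :=
  continuous_integral_bcf (continuous_potentialKernel.comp continuous_snd)
    (hν.comp continuous_fst)

theorem integral_real_Iic_mul (m : FiniteMeasure ℝ) {φ : ℝ → ℝ} (hφ : ContDiff ℝ 1 φ)
    (hc : HasCompactSupport φ) :
    ∫ x, (m : Measure ℝ).real (Iic x) * φ x = -∫ x, potential m x * deriv φ x := by
  rw [integral_mul_deriv_eq_neg (fun a b =>
    ((lipschitzWith_potential m).lipschitzOnWith).absolutelyContinuousOnInterval)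
    (ae_hasDerivAt_potential m) hφ hc, neg_neg]

/-! ### The balance of momentum -/

/-- The flux `v² / 2 - (1 / 2) ∫₀ˣ F` of the momentum. -/
def momentumFlux (v : ℝ → (ℝ →ᵇ ℝ)) (ν : ℝ → FiniteMeasure ℝ) (t x : ℝ) : ℝ :=
  v t x ^ 2 / 2 - potential (ν t) x / 2

namespace IsConservativeSolution

variable {u₀ : ℝ →ᵇ ℝ} {μ₀ : FiniteMeasure ℝ} {v : ℝ → (ℝ →ᵇ ℝ)} {ν : ℝ → FiniteMeasure ℝ}

theorem continuous_momentumFlux (hv : IsConservativeSolution u₀ μ₀ v ν) :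
    Continuous fun p : ℝ × ℝ => momentumFlux v ν p.1 p.2 :=
  ((hv.continuous_uncurry.pow 2).div_const 2).sub ((continuous_potential hv.continuous_μ).div_const 2)

theorem continuous_integral_momentumFlux_mul (hv : IsConservativeSolution u₀ μ₀ v ν) {ρ : ℝ → ℝ}
    (hρ : Continuous ρ) (hρc : HasCompactSupport ρ) :
    Continuous fun t => ∫ x, momentumFlux v ν t x * ρ x := by
  obtain ⟨R, -, hR⟩ := exists_pos_forall_abs_le_of_hasCompactSupport hρc
  have h1 : ∀ t, ∫ x, momentumFlux v ν t x * ρ x =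
      ∫ x in (-R)..R, momentumFlux v ν t x * ρ x := fun t =>
    integral_eq_intervalIntegral_of_forall_abs_le fun x hx => by rw [hR x hx, mul_zero]
  simp_rw [h1]
  exact intervalIntegral.continuous_parametric_intervalIntegral_of_continuous'
    (hv.continuous_momentumFlux.mul (hρ.comp continuous_snd)) _ _

theorem continuous_integral_mul (hv : IsConservativeSolution u₀ μ₀ v ν) {ρ : ℝ → ℝ}
    (hρ : Continuous ρ) (hρc : HasCompactSupport ρ) :
    Continuous fun t => ∫ x, v t x * ρ x := by
  obtain ⟨R, -, hR⟩ := exists_pos_forall_abs_le_of_hasCompactSupport hρc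
  have h1 : ∀ t, ∫ x, v t x * ρ x = ∫ x in (-R)..R, v t x * ρ x := fun t =>
    integral_eq_intervalIntegral_of_forall_abs_le fun x hx => by rw [hR x hx, mul_zero]
  simp_rw [h1]
  exact intervalIntegral.continuous_parametric_intervalIntegral_of_continuous'
    (hv.continuous_uncurry.mul (hρ.comp continuous_snd)) _ _

/-- At a fixed time the source `v v_x - F / 2` is the weak space derivative of the momentum flux. -/
theorem integral_source_mul {ux : ℝ → ℝ} {t : ℝ}
    (hux : IsWeakDeriv (v t) ux) {ρ : ℝ → ℝ} (hρ : ContDiff ℝ ∞ ρ) (hρc : HasCompactSupport ρ) :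
    ∫ x, (v t x * ux x - 1 / 2 * (ν t : Measure ℝ).real (Iic x)) * ρ x =
      -∫ x, momentumFlux v ν t x * deriv ρ x := by
  have hρ1 : ContDiff ℝ 1 ρ := hρ.of_le (by simp)
  have hdc : Continuous (deriv ρ) := hρ.continuous_deriv (by simp)
  have e1 := hux.integral_mul_mul (v t).continuous hρ1 hρc
  have e2 := integral_real_Iic_mul (ν t) hρ1 hρc
  have hvρ : Continuous fun x => v t x * ρ x := (v t).continuous.mul hρ.continuous
  have i1 : Integrable fun x => v t x * ux x * ρ x := by
    have := hux.locallyIntegrable_deriv.integrable_smul_left_of_hasCompactSupport hvρ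
      hρc.mul_left
    refine this.congr (ae_of_all _ fun x => ?_)
    simp only [smul_eq_mul]
    ring
  have i2 : Integrable fun x => (ν t : Measure ℝ).real (Iic x) * ρ x := by
    have hm : Monotone fun x => (ν t : Measure ℝ).real (Iic x) := fun _ _ h => real_Iic_mono _ h
    have := hm.locallyIntegrable (μ := volume) |>.integrable_smul_left_of_hasCompactSupport
      hρ.continuous hρc
    refine this.congr (ae_of_all _ fun x => ?_)
    simp only [smul_eq_mul]
    ring
  have hpc : Continuous (potential (ν t)) := (lipschitzWith_potential (ν t)).continuous
  have i3 : Integrable fun x => v t x ^ 2 / 2 * deriv ρ x :=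
    ((((v t).continuous.pow 2).div_const 2).mul hdc).integrable_of_hasCompactSupport
      hρc.deriv.mul_left
  have i4 : Integrable fun x => potential (ν t) x * deriv ρ x :=
    (hpc.mul hdc).integrable_of_hasCompactSupport hρc.deriv.mul_left
  have s1 : ∫ x, (v t x * ux x - 1 / 2 * (ν t : Measure ℝ).real (Iic x)) * ρ x =
      (∫ x, v t x * ux x * ρ x) - 1 / 2 * ∫ x, (ν t : Measure ℝ).real (Iic x) * ρ x := by
    rw [← integral_const_mul, ← integral_sub i1 (i2.const_mul _)]
    exact integral_congr_ae (ae_of_all _ fun x => by ring)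
  have s2 : ∫ x, momentumFlux v ν t x * deriv ρ x =
      (∫ x, v t x ^ 2 / 2 * deriv ρ x) - 1 / 2 * ∫ x, potential (ν t) x * deriv ρ x := by
    rw [← integral_const_mul, ← integral_sub i3 (i4.const_mul _)]
    exact integral_congr_ae (ae_of_all _ fun x => by simp only [momentumFlux]; ring)
  rw [s1, s2, e1, e2]
  ring

/-- The weak form of the momentum equation, integrated in time. -/
theorem integral_mul_sub_integral_mul (hv : IsConservativeSolution u₀ μ₀ v ν) {ρ : ℝ → ℝ}
    (hρ : ContDiff ℝ ∞ ρ) (hρc : HasCompactSupport ρ) (t₁ t₂ : ℝ) :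
    (∫ x, v t₂ x * ρ x) - ∫ x, v t₁ x * ρ x =
      ∫ t in t₁..t₂, ∫ x, momentumFlux v ν t x * deriv ρ x := by
  have hdc : Continuous (deriv ρ) := hρ.continuous_deriv (by simp)
  have hE := hv.continuous_integral_mul hρ.continuous hρc
  have hD := hv.continuous_integral_momentumFlux_mul hdc hρc.deriv
  obtain ⟨ux, hux, -, hweak, -⟩ := hv.exists_ux
  refine IsWeakDeriv.sub_eq_integral (f := fun t => ∫ x, v t x * ρ x)
    (g := fun t => ∫ x, momentumFlux v ν t x * deriv ρ x)
    ⟨hE.locallyIntegrable, hD.locallyIntegrable, fun χ hχ hχc => ?_⟩ hE t₁ t₂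
  -- Speed `0` gives the product test function `ρ(x) χ(t)`.
  have h0 := hweak _ (isTestFunction_shift_mul hρ hρc hχ hχc 0)
  have h1 : ∀ t, ∫ x, (v t x * dt (fun p : ℝ × ℝ => ρ (p.1 - 0 * p.2) * χ p.2) x t -
      ρ (x - 0 * t) * χ t * (v t x * ux t x - 1 / 2 * (ν t : Measure ℝ).real (Iic x))) =
      (∫ x, v t x * ρ x) * deriv χ t + (∫ x, momentumFlux v ν t x * deriv ρ x) * χ t := by
    intro t
    have i1 : Integrable fun x => v t x * ρ x :=
      ((v t).continuous.mul hρ.continuous).integrable_of_hasCompactSupport hρc.mul_left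
    have i2 : Integrable
        fun x => (v t x * ux t x - 1 / 2 * (ν t : Measure ℝ).real (Iic x)) * ρ x := by
      have hm : Monotone fun x => (ν t : Measure ℝ).real (Iic x) := fun _ _ h => real_Iic_mono _ h
      have hl : LocallyIntegrable
          fun x => v t x * ux t x - 1 / 2 * (ν t : Measure ℝ).real (Iic x) := by
        refine LocallyIntegrable.sub ?_ ((hm.locallyIntegrable (μ := volume)).smul (1 / 2 : ℝ))
        exact (hux t).1.locallyIntegrable_deriv.continuous_smul (v t).continuous
      have := hl.integrable_smul_left_of_hasCompactSupport hρ.continuous hρc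
      refine this.congr (ae_of_all _ fun x => ?_)
      simp only [smul_eq_mul]
      ring
    have h2 := integral_source_mul (ν := ν) (hux t).1 hρ hρc
    rw [← neg_neg (∫ x, momentumFlux v ν t x * deriv ρ x), ← h2, neg_mul, ← sub_eq_add_neg,
      ← integral_mul_const, ← integral_mul_const,
      ← integral_sub (i1.mul_const _) (i2.mul_const _)]
    refine integral_congr_ae (ae_of_all _ fun x => ?_)
    beta_reduce
    rw [dt_shift_mul hρ hχ]
    simp only [zero_mul, sub_zero, neg_zero]
    ring
  simp_rw [h1] at h0
  rw [integral_add] at h0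
  · linarith
  · exact (hE.mul (hχ.continuous_deriv (by simp))).integrable_of_hasCompactSupport
      hχc.deriv.mul_left
  · exact (hD.mul hχ.continuous).integrable_of_hasCompactSupport hχc.mul_left

/-- The balance of momentum on an interval. -/
theorem integral_momentumFlux_sub (hv : IsConservativeSolution u₀ μ₀ v ν) (t₁ t₂ a b : ℝ) :
    (∫ t in t₁..t₂, momentumFlux v ν t b) - ∫ t in t₁..t₂, momentumFlux v ν t a =
      -((∫ x in a..b, v t₂ x) - ∫ x in a..b, v t₁ x) := by
  have hNc := hv.continuous_momentumFlux
  have hc : Continuous fun x => ∫ t in t₁..t₂, momentumFlux v ν t x :=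
    intervalIntegral.continuous_parametric_intervalIntegral_of_continuous'
      (f := fun x t => momentumFlux v ν t x) (hNc.comp continuous_swap) _ _
  have hd : Continuous fun x => -(v t₂ x - v t₁ x) :=
    ((v t₂).continuous.sub (v t₁).continuous).neg
  -- By Fubini, the weak momentum equation becomes a weak derivative in `x` of the time-integrated
  -- flux; both sides are continuous, so it integrates over `[a, b]`.
  have hw : IsWeakDeriv (fun x => ∫ t in t₁..t₂, momentumFlux v ν t x)
      fun x => -(v t₂ x - v t₁ x) := by
    refine ⟨hc.locallyIntegrable, hd.locallyIntegrable, fun ρ hρ hρc => ?_⟩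
    have hdc : Continuous (deriv ρ) := hρ.continuous_deriv (by simp)
    have h1 := hv.integral_mul_sub_integral_mul hρ hρc t₁ t₂
    obtain ⟨R, -, hR⟩ := exists_pos_forall_abs_le_of_hasCompactSupport hρc.deriv
    have h2 : ∀ t, ∫ x, momentumFlux v ν t x * deriv ρ x =
        ∫ x in (-R)..R, momentumFlux v ν t x * deriv ρ x := fun t =>
      integral_eq_intervalIntegral_of_forall_abs_le fun x hx => by rw [hR x hx, mul_zero]
    simp_rw [h2] at h1
    rw [intervalIntegral_intervalIntegral_swap] at h1
    · rw [integral_eq_intervalIntegral_of_forall_abs_le (R := R)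
        (fun x hx => by rw [hR x hx, mul_zero])]
      simp_rw [intervalIntegral.integral_mul_const] at h1
      have i1 : ∀ t, Integrable fun x => v t x * ρ x := fun t =>
        ((v t).continuous.mul hρ.continuous).integrable_of_hasCompactSupport hρc.mul_left
      rw [← h1, ← integral_neg, ← integral_sub (i1 t₂) (i1 t₁)]
      exact integral_congr_ae (ae_of_all _ fun x => by ring)
    · have hcc : Continuous (Function.uncurry fun t x => momentumFlux v ν t x * deriv ρ x) :=
        hNc.mul (hdc.comp continuous_snd)
      exact (hcc.continuousOn.integrableOn_compact (isCompact_uIcc.prod isCompact_uIcc)).mono_set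
        (prod_mono uIoc_subset_uIcc uIoc_subset_uIcc)
  rw [hw.sub_eq_integral hc, intervalIntegral.integral_neg, intervalIntegral.integral_sub
    ((v t₂).continuous.intervalIntegrable _ _) ((v t₁).continuous.intervalIntegrable _ _)]

/-- The momentum `∫₀ˣ v (z, t) dz` is a `C¹` function along differentiable curves. -/
theorem hasDerivAt_momentum (hv : IsConservativeSolution u₀ μ₀ v ν) {γ : ℝ → ℝ} {γ' t : ℝ}
    (hγ : HasDerivAt γ γ' t) :
    HasDerivAt (fun s => ∫ z in (0 : ℝ)..γ s, v s z)
      (v t (γ t) * γ' - (momentumFlux v ν t (γ t) - momentumFlux v ν t 0)) t := by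
  have hNc := hv.continuous_momentumFlux
  have hN : ∀ x, Continuous fun s => momentumFlux v ν s x := fun x =>
    hNc.comp (continuous_id.prodMk continuous_const)
  have hN0 : ∀ x, Continuous fun s => momentumFlux v ν s x - momentumFlux v ν s 0 := fun x =>
    (hN x).sub (hN 0)
  set f₁ : ℝ → ℝ → ℝ →L[ℝ] ℝ := fun s x =>
    ContinuousLinearMap.toSpanSingleton ℝ (-(momentumFlux v ν s x - momentumFlux v ν s 0)) with hf₁
  set f₂ : ℝ → ℝ → ℝ →L[ℝ] ℝ := fun s x => ContinuousLinearMap.toSpanSingleton ℝ (v s x) with hf₂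
  have hspan : Continuous fun r : ℝ => ContinuousLinearMap.toSpanSingleton ℝ r :=
    (ContinuousLinearMap.toSpanSingletonCLE (𝕜 := ℝ) (E := ℝ)).continuous
  have d₁ : ∀ s x, HasDerivAt (fun r => ∫ z in (0 : ℝ)..x, v r z)
      (-(momentumFlux v ν s x - momentumFlux v ν s 0)) s := by
    intro s x
    have e : (fun r => ∫ z in (0 : ℝ)..x, v r z) = fun r => (∫ z in (0 : ℝ)..x, v 0 z) -
        ∫ τ in (0 : ℝ)..r, (momentumFlux v ν τ x - momentumFlux v ν τ 0) := by
      funext r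
      rw [intervalIntegral.integral_sub ((hN x).intervalIntegrable _ _)
        ((hN 0).intervalIntegrable _ _), hv.integral_momentumFlux_sub 0 r 0 x]
      ring
    rw [e]
    exact (intervalIntegral.integral_hasDerivAt_right ((hN0 x).intervalIntegrable _ _)
      ((hN0 x).stronglyMeasurableAtFilter _ _) (hN0 x).continuousAt).const_sub _
  have d₂ : ∀ s x, HasDerivAt (fun y => ∫ z in (0 : ℝ)..y, v s z) (v s x) x := fun s x =>
    intervalIntegral.integral_hasDerivAt_right ((v s).continuous.intervalIntegrable _ _)
      ((v s).continuous.stronglyMeasurableAtFilter _ _) (v s).continuous.continuousAt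
  -- Both partial derivatives exist everywhere and are jointly continuous, so the chain rule
  -- applies.
  have hmain := hasStrictFDerivAt_uncurry_coprod (𝕜 := ℝ) (u := (t, γ t))
    (f := fun s x => ∫ z in (0 : ℝ)..x, v s z) (f₁ := f₁) (f₂ := f₂)
    (Eventually.of_forall fun p => (d₁ p.1 p.2).hasFDerivAt)
    (Eventually.of_forall fun p => (d₂ p.1 p.2).hasFDerivAt)
    (hspan.comp (hNc.sub (hNc.comp (continuous_fst.prodMk continuous_const))).neg).continuousAt
    (hspan.comp hv.continuous_uncurry).continuousAt
  have h2 := hmain.hasFDerivAt.comp_hasDerivAt t ((hasDerivAt_id t).prodMk hγ)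
  refine HasDerivAt.congr_deriv h2 ?_
  change (1 : ℝ) • (-(momentumFlux v ν t (γ t) - momentumFlux v ν t 0)) + γ' • v t (γ t) = _
  rw [smul_eq_mul, smul_eq_mul]
  ring

end IsConservativeSolution

/-! ### The velocity along characteristics -/

theorem hasDerivAt_quadratic (x w a t : ℝ) :
    HasDerivAt (fun s : ℝ => x + w * s + s ^ 2 / 4 * a) (w + t / 2 * a) t := by
  have h1 : HasDerivAt (fun s : ℝ => x + w * s) (w * 1) t :=
    ((hasDerivAt_id t).const_mul w).const_add x
  have h2 := ((hasDerivAt_pow 2 t).div_const 4).mul_const a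
  refine HasDerivAt.congr_deriv (h1.add h2) ?_
  push_cast
  ring

theorem eq_of_hasDerivAt_eq {f g f' : ℝ → ℝ} (hf : ∀ t, HasDerivAt f (f' t) t)
    (hg : ∀ t, HasDerivAt g (f' t) t) (h0 : f 0 = g 0) (t : ℝ) : f t = g t := by
  have hd : ∀ t, HasDerivAt (f - g) 0 t := fun t => ((hf t).sub (hg t)).congr_deriv (sub_self _)
  have h := is_const_of_deriv_eq_zero (fun t => (hd t).differentiableAt) (fun t => (hd t).deriv) t 0
  simp only [Pi.sub_apply, h0, sub_self] at h
  linarith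

namespace IsConservativeSolution

variable {u₀ : ℝ →ᵇ ℝ} {μ₀ : FiniteMeasure ℝ} {v : ℝ → (ℝ →ᵇ ℝ)} {ν : ℝ → FiniteMeasure ℝ}

/-- Along a characteristic that carries the constant energy `a` on its left, the velocity is affine
in time with slope `a / 2`. -/
theorem velocity_eq (hv : IsConservativeSolution u₀ μ₀ v ν) {γ : ℝ → ℝ} {a : ℝ}
    (hγ : ∀ t, HasDerivAt γ (v t (γ t)) t)
    (he : ∀ᵐ t, (ν t : Measure ℝ).real (Iic (γ t)) = a) (t : ℝ) :
    v t (γ t) = v 0 (γ 0) + t / 2 * a := by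
  have hγc : Continuous γ := continuous_iff_continuousAt.2 fun t => (hγ t).continuousAt
  set W : ℝ → ℝ → ℝ := fun s x => ∫ z in (0 : ℝ)..x, v s z with hW
  -- `Δ ε` is the momentum in `[γ, γ + ε]`. Both endpoints move with speed `v(γ)`, so the quadratic
  -- terms of its derivative combine to the square in `g`, and the fluxes at `0` cancel.
  set Δ : ℝ → ℝ → ℝ := fun ε s => W s (γ s + ε) - W s (γ s) with hΔ
  set g : ℝ → ℝ → ℝ := fun ε s => 1 / 2 * (potential (ν s) (γ s + ε) - potential (ν s) (γ s)) -
    1 / 2 * (v s (γ s + ε) - v s (γ s)) ^ 2 with hg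
  have hvc := hv.continuous_uncurry
  have hpc := continuous_potential hv.continuous_μ
  have hgc : ∀ ε, Continuous (g ε) := by
    intro ε
    have c1 : Continuous fun s => (s, γ s + ε) :=
      continuous_id.prodMk (hγc.add continuous_const)
    have c2 : Continuous fun s => (s, γ s) := continuous_id.prodMk hγc
    exact (continuous_const.mul ((hpc.comp c1).sub (hpc.comp c2))).sub
      (continuous_const.mul (((hvc.comp c1).sub (hvc.comp c2)).pow 2))
  have hΔd : ∀ ε s, HasDerivAt (Δ ε) (g ε s) s := by
    intro ε s
    refine ((hv.hasDerivAt_momentum ((hγ s).add_const ε)).sub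
      (hv.hasDerivAt_momentum (hγ s))).congr_deriv ?_
    simp only [hg, momentumFlux]
    ring
  have hint : ∀ ε, ∫ s in (0 : ℝ)..t, g ε s = Δ ε t - Δ ε 0 := fun ε =>
    intervalIntegral.integral_eq_sub_of_hasDerivAt (fun s _ => hΔd ε s)
      ((hgc ε).intervalIntegrable _ _)
  have hlim : ∀ s, Tendsto (fun ε => ε⁻¹ * Δ ε s) (𝓝[>] 0) (𝓝 (v s (γ s))) := by
    intro s
    have : HasDerivAt (W s) (v s (γ s)) (γ s) :=
      intervalIntegral.integral_hasDerivAt_right ((v s).continuous.intervalIntegrable _ _)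
        ((v s).continuous.stronglyMeasurableAtFilter _ _) (v s).continuous.continuousAt
    exact this.tendsto_slope_zero_right
  have hL : Tendsto (fun ε => ∫ s in (0 : ℝ)..t, ε⁻¹ * g ε s) (𝓝[>] 0)
      (𝓝 (v t (γ t) - v 0 (γ 0))) := by
    refine ((hlim t).sub (hlim 0)).congr fun ε => ?_
    rw [intervalIntegral.integral_const_mul, hint ε]
    ring
  set M := (ν 0 : Measure ℝ).real univ with hM
  have hGM : ∀ s x, (ν s : Measure ℝ).real (Iic x) ≤ M := fun s x =>
    (measureReal_mono (subset_univ _)).trans_eq (hv.real_univ_eq s 0)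
  have hG0 : ∀ s x, 0 ≤ (ν s : Measure ℝ).real (Iic x) := fun s x => measureReal_nonneg
  have hsq : ∀ s ε, 0 < ε → ε⁻¹ * (v s (γ s + ε) - v s (γ s)) ^ 2 ≤
      (ν s : Measure ℝ).real (Iic (γ s + ε)) - (ν s : Measure ℝ).real (Iic (γ s)) := by
    intro s ε hε
    rw [inv_mul_le_iff₀ hε]
    refine (hv.sq_sub_le_real_Iio s (le_add_of_nonneg_right hε.le)).trans ?_
    rw [add_sub_cancel_left]
    refine mul_le_mul_of_nonneg_left ?_ hε.le
    linarith [measureReal_mono (μ := (ν s : Measure ℝ)) (Iio_subset_Iic_self (a := γ s + ε))]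
  have hsq0 : ∀ s ε, 0 < ε → 0 ≤ ε⁻¹ * (v s (γ s + ε) - v s (γ s)) ^ 2 := fun s ε hε =>
    mul_nonneg (inv_nonneg.2 hε.le) (sq_nonneg _)
  have hpot : ∀ s ε, 0 < ε →
      (ν s : Measure ℝ).real (Iic (γ s)) ≤
        ε⁻¹ * (potential (ν s) (γ s + ε) - potential (ν s) (γ s)) ∧
      ε⁻¹ * (potential (ν s) (γ s + ε) - potential (ν s) (γ s)) ≤
        (ν s : Measure ℝ).real (Iic (γ s + ε)) := by
    intro s ε hε
    have h1 := mul_real_Iic_le_potential_sub (ν s) (le_add_of_nonneg_right hε.le : γ s ≤ γ s + ε)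
    have h2 := potential_sub_le_mul_real_Iic (ν s) (le_add_of_nonneg_right hε.le : γ s ≤ γ s + ε)
    rw [add_sub_cancel_left] at h1 h2
    rw [le_inv_mul_iff₀ hε, inv_mul_le_iff₀ hε]
    exact ⟨h1, h2⟩
  have hgε : ∀ s ε, ε⁻¹ * g ε s =
      1 / 2 * (ε⁻¹ * (potential (ν s) (γ s + ε) - potential (ν s) (γ s))) -
        1 / 2 * (ε⁻¹ * (v s (γ s + ε) - v s (γ s)) ^ 2) := fun s ε => by
    simp only [hg]
    ring
  -- Dominated convergence with the conserved total energy as bound: the potential slope tends to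
  -- `a` for a.e. time, and the square is at most the energy in `(γ, γ + ε]`, which shrinks to the
  -- empty set.
  have hR : Tendsto (fun ε => ∫ s in (0 : ℝ)..t, ε⁻¹ * g ε s) (𝓝[>] 0)
      (𝓝 (∫ _s in (0 : ℝ)..t, 1 / 2 * a)) := by
    refine intervalIntegral.tendsto_integral_filter_of_dominated_convergence (fun _ => M) ?_ ?_
      intervalIntegrable_const ?_
    · exact Eventually.of_forall fun ε => (continuous_const.mul (hgc ε)).aestronglyMeasurable
    · filter_upwards [self_mem_nhdsWithin] with ε (hε : 0 < ε)
      refine ae_of_all _ fun s _ => ?_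
      rw [hgε, Real.norm_eq_abs, abs_le]
      have a1 := hpot s ε hε
      have a2 := hsq s ε hε
      have a3 := hsq0 s ε hε
      have a4 := hGM s (γ s + ε)
      have a5 := hG0 s (γ s)
      constructor <;> linarith
    · filter_upwards [he] with s hs _
      have b1 := tendsto_const_add_nhdsGT_zero (γ s)
      have b2 := (tendsto_real_Iic_nhdsGT (ν s : Measure ℝ) (γ s)).comp b1
      have b3 : Tendsto (fun ε => ε⁻¹ * (v s (γ s + ε) - v s (γ s)) ^ 2) (𝓝[>] 0) (𝓝 0) := by
        have b4 := b2.sub_const ((ν s : Measure ℝ).real (Iic (γ s)))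
        rw [sub_self] at b4
        refine tendsto_of_tendsto_of_tendsto_of_le_of_le' tendsto_const_nhds b4 ?_ ?_
        · filter_upwards [self_mem_nhdsWithin] with ε hε using hsq0 s ε hε
        · filter_upwards [self_mem_nhdsWithin] with ε hε using hsq s ε hε
      have b5 := ((tendsto_potential_slope (ν s) (γ s)).const_mul (1 / 2)).sub
        (b3.const_mul (1 / 2))
      rw [mul_zero, sub_zero, hs] at b5
      exact b5.congr fun ε => (hgε s ε).symm
  have := tendsto_nhds_unique hL hR
  rw [intervalIntegral.integral_const, smul_eq_mul, sub_zero] at this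
  linarith

theorem ae_real_Iic_eq (hv : IsConservativeSolution u₀ μ₀ v ν) {γ : ℝ → ℝ} {a : ℝ}
    (he : ∀ᵐ t, (ν t : Measure ℝ).real (Iio (γ t)) ≤ a ∧ a ≤ (ν t : Measure ℝ).real (Iic (γ t))) :
    ∀ᵐ t, (ν t : Measure ℝ).real (Iic (γ t)) = a := by
  filter_upwards [he, hv.ae_real_Iio_eq] with t h1 h2
  rw [h2] at h1
  exact le_antisymm h1.1 h1.2

/-- A characteristic of constant energy is a parabola. -/
theorem characteristic_eq (hv : IsConservativeSolution u₀ μ₀ v ν) {γ : ℝ → ℝ} {a : ℝ}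
    (hγ : ∀ t, HasDerivAt γ (v t (γ t)) t)
    (he : ∀ᵐ t, (ν t : Measure ℝ).real (Iio (γ t)) ≤ a ∧ a ≤ (ν t : Measure ℝ).real (Iic (γ t)))
    (t : ℝ) : γ t = γ 0 + u₀ (γ 0) * t + t ^ 2 / 4 * a := by
  have h1 := hv.velocity_eq hγ (hv.ae_real_Iic_eq he)
  rw [hv.initial_u] at h1
  -- The right-hand side of the ODE is now an explicit function of time, so uniqueness needs no
  -- regularity of `v`.
  refine eq_of_hasDerivAt_eq (f' := fun s => u₀ (γ 0) + s / 2 * a)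
    (fun s => (hγ s).congr_deriv (h1 s)) (fun s => hasDerivAt_quadratic _ _ _ _) ?_ t
  simp

/-- The quantiles of the energy are parabolas. -/
theorem quantile_eq (hv : IsConservativeSolution u₀ μ₀ v ν) {a : ℝ} (ha : 0 < a)
    (hne : ∃ x, a ≤ (μ₀ : Measure ℝ).real (Iic x)) (t : ℝ) :
    quantile (ν t) a = quantile μ₀ a + u₀ (quantile μ₀ a) * t + t ^ 2 / 4 * a ∧
      v t (quantile (ν t) a) = u₀ (quantile μ₀ a) + t / 2 * a := by
  have hne0 : ∃ x, a ≤ (ν 0 : Measure ℝ).real (Iic x) := by rwa [hv.initial_μ]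
  have hγ := hv.hasDerivAt_quantile ha hne0
  have he : ∀ᵐ t, (ν t : Measure ℝ).real (Iio (quantile (ν t) a)) ≤ a ∧
      a ≤ (ν t : Measure ℝ).real (Iic (quantile (ν t) a)) := ae_of_all _ fun t =>
    ⟨real_Iio_quantile_le ha, le_real_Iic_quantile (hv.exists_le_real_Iic hne0 t)⟩
  have h1 := hv.characteristic_eq hγ he t
  have h2 := hv.velocity_eq hγ (hv.ae_real_Iic_eq he) t
  rw [hv.initial_μ] at h1 h2
  rw [hv.initial_u] at h2
  exact ⟨h1, h2⟩

end IsConservativeSolution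

/-! ### Existence of characteristics -/

theorem sq_neg_add_add_le (p q r : ℝ) : (-p + q + r) ^ 2 ≤ 3 * (p ^ 2 + q ^ 2 + r ^ 2) := by
  nlinarith [sq_nonneg (p + q), sq_nonneg (p + r), sq_nonneg (q - r)]

namespace IsConservativeSolution

variable {u₀ : ℝ →ᵇ ℝ} {μ₀ : FiniteMeasure ℝ} {v : ℝ → (ℝ →ᵇ ℝ)} {ν : ℝ → FiniteMeasure ℝ}

theorem sq_initial_sub_le (hv : IsConservativeSolution u₀ μ₀ v ν) {p q : ℝ} (hpq : p ≤ q) :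
    (u₀ q - u₀ p) ^ 2 ≤
      (q - p) * ((μ₀ : Measure ℝ).real (Iio q) - (μ₀ : Measure ℝ).real (Iic p)) := by
  have := hv.sq_sub_le_real_Iio 0 hpq
  rwa [hv.initial_u, hv.initial_μ] at this

/-- The two bounds leave no energy strictly between `p` and `q`, so the increment bound forces
equality. -/
theorem eq_of_energy_le (hv : IsConservativeSolution u₀ μ₀ v ν) {t p q a : ℝ} (hpq : p ≤ q)
    (hp : a ≤ (ν t : Measure ℝ).real (Iic p)) (hq : (ν t : Measure ℝ).real (Iio q) ≤ a) :
    v t q = v t p := by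
  have h1 : (v t q - v t p) ^ 2 ≤ 0 := (hv.sq_sub_le_real_Iio t hpq).trans
    (mul_nonpos_of_nonneg_of_nonpos (sub_nonneg.2 hpq) (by linarith))
  exact sub_eq_zero.1 (pow_eq_zero_iff two_ne_zero |>.1 (le_antisymm h1 (sq_nonneg _)))

/-- Between the left quantile of level `a` and `x` there is initially no energy, so `u₀` agrees at
both and the two parabolas are translates. -/
theorem parabola_eq_quantile_add (hv : IsConservativeSolution u₀ μ₀ v ν) {x a : ℝ}
    (h₁ : (μ₀ : Measure ℝ).real (Iio x) ≤ a) (h₂ : a ≤ (μ₀ : Measure ℝ).real (Iic x)) (ha : 0 < a) (t : ℝ) :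
    x + u₀ x * t + t ^ 2 / 4 * a = quantile (ν t) a + (x - quantile μ₀ a) ∧
      quantile μ₀ a ≤ x ∧ v t (quantile (ν t) a) = u₀ x + t / 2 * a := by
  obtain ⟨e1, e2⟩ := hv.quantile_eq ha ⟨x, h₂⟩ t
  have hle : quantile μ₀ a ≤ x := quantile_le ha h₂
  have hu : u₀ x = u₀ (quantile μ₀ a) := by
    have := hv.eq_of_energy_le (t := 0) (p := quantile μ₀ a) (q := x) (a := a) hle
    rw [hv.initial_u, hv.initial_μ] at this
    exact this (le_real_Iic_quantile ⟨x, h₂⟩) h₁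
  refine ⟨?_, hle, ?_⟩
  · rw [e1, hu]
    ring
  · rw [e2, hu]

/-- Labels with more energy on their left stay to the right. -/
theorem parabola_le_quantile (hv : IsConservativeSolution u₀ μ₀ v ν) {x a : ℝ}
    (h₁ : (μ₀ : Measure ℝ).real (Iio x) ≤ a) (h₂ : a ≤ (μ₀ : Measure ℝ).real (Iic x)) {b : ℝ} (hab : a < b)
    (hne : ∃ z, b ≤ (μ₀ : Measure ℝ).real (Iic z)) (t : ℝ) :
    x ≤ quantile μ₀ b ∧ (u₀ (quantile μ₀ b) - u₀ x) ^ 2 ≤ (quantile μ₀ b - x) * (b - a) ∧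
      x + u₀ x * t + t ^ 2 / 4 * a ≤ quantile (ν t) b ∧
      quantile (ν t) b - (x + u₀ x * t + t ^ 2 / 4 * a) ≤
        2 * ((quantile μ₀ b - x) + (b - a) * t ^ 2 / 4) := by
  have hb : 0 < b := (measureReal_nonneg.trans h₁).trans_lt hab
  obtain ⟨e1, -⟩ := hv.quantile_eq hb hne t
  set q := quantile μ₀ b with hq
  have hle : x ≤ q := by
    by_contra hcon
    have h3 := (le_real_Iic_quantile hne).trans
      (real_Iic_le_real_Iio (μ₀ : Measure ℝ) (not_le.1 hcon))
    linarith
  have hX : 0 ≤ q - x := sub_nonneg.2 hle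
  have hB : 0 ≤ b - a := (sub_pos.2 hab).le
  have hD : (u₀ q - u₀ x) ^ 2 ≤ (q - x) * (b - a) := by
    refine (hv.sq_initial_sub_le hle).trans (mul_le_mul_of_nonneg_left ?_ hX)
    have : (μ₀ : Measure ℝ).real (Iio q) ≤ b := real_Iio_quantile_le hb
    linarith
  -- This is the discriminant condition `D² ≤ X B` for `X + D t + B t² / 4`, where `X = q - x`, `D =
  -- u₀ q - u₀ x`, `B = b - a`; it prevents crossing.
  have hDt : |(u₀ q - u₀ x) * t| ≤ (q - x) + (b - a) * t ^ 2 / 4 := by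
    refine abs_le_of_sq_le_sq ?_ (by positivity)
    have h4 : ((u₀ q - u₀ x) * t) ^ 2 ≤ (q - x) * (b - a) * t ^ 2 := by
      rw [mul_pow]
      exact mul_le_mul_of_nonneg_right hD (sq_nonneg t)
    nlinarith [sq_nonneg ((q - x) - (b - a) * t ^ 2 / 4)]
  obtain ⟨h5, h6⟩ := abs_le.1 hDt
  refine ⟨hle, hD, ?_, ?_⟩
  · rw [e1]
    linarith
  · rw [e1]
    linarith

theorem le_real_Iic_parabola (hv : IsConservativeSolution u₀ μ₀ v ν) {x a : ℝ}
    (h₁ : (μ₀ : Measure ℝ).real (Iio x) ≤ a) (h₂ : a ≤ (μ₀ : Measure ℝ).real (Iic x)) (t : ℝ) :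
    a ≤ (ν t : Measure ℝ).real (Iic (x + u₀ x * t + t ^ 2 / 4 * a)) := by
  rcases (measureReal_nonneg.trans h₁).eq_or_lt with ha | ha
  · rw [← ha]
    exact measureReal_nonneg
  · obtain ⟨e1, hle, -⟩ := hv.parabola_eq_quantile_add h₁ h₂ ha t
    have hne : ∃ z, a ≤ (ν 0 : Measure ℝ).real (Iic z) := ⟨x, by rwa [hv.initial_μ]⟩
    refine (le_real_Iic_quantile (hv.exists_le_real_Iic hne t)).trans (real_Iic_mono _ ?_)
    rw [e1]
    linarith

/-- A quantile of level `b > a` never lies left of the parabola, so any point strictly left of the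
parabola has energy below `b` on its left; then `b` decreases to `a`. -/
theorem real_Iio_parabola_le (hv : IsConservativeSolution u₀ μ₀ v ν) {x a : ℝ}
    (h₁ : (μ₀ : Measure ℝ).real (Iio x) ≤ a) (h₂ : a ≤ (μ₀ : Measure ℝ).real (Iic x)) (t : ℝ) :
    (ν t : Measure ℝ).real (Iio (x + u₀ x * t + t ^ 2 / 4 * a)) ≤ a := by
  have huniv : (ν t : Measure ℝ).real univ = (μ₀ : Measure ℝ).real univ := by
    rw [hv.real_univ_eq t 0, hv.initial_μ]
  rcases le_or_gt ((μ₀ : Measure ℝ).real univ) a with hM | hM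
  · exact (measureReal_mono (subset_univ _)).trans (huniv.trans_le hM)
  · refine real_Iio_le_of_forall_lt _ fun z hz => le_of_forall_gt_imp_ge_of_dense fun b hb => ?_
    rcases le_or_gt ((μ₀ : Measure ℝ).real univ) b with hMb | hMb
    · exact (measureReal_mono (subset_univ _)).trans (huniv.trans_le hMb)
    · have hne : ∃ z, b ≤ (μ₀ : Measure ℝ).real (Iic z) :=
        ((tendsto_real_Iic_atTop (μ₀ : Measure ℝ)).eventually (lt_mem_nhds hMb)).exists.imp
          fun _ h => le_of_lt h
      obtain ⟨-, -, h3, -⟩ := hv.parabola_le_quantile h₁ h₂ hb hne t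
      exact (real_Iic_lt_of_lt_quantile ((measureReal_nonneg.trans h₁).trans_lt hb)
        (hz.trans_le h3)).le

/-- The velocity is known at quantiles of levels `b > a`, and between the parabola and such a
quantile there is energy at most `b - a`. The distance to the quantile need not vanish as `b`
decreases to `a`, but its product with `b - a` does. -/
theorem velocity_parabola_of_lt (hv : IsConservativeSolution u₀ μ₀ v ν) {x a : ℝ}
    (h₁ : (μ₀ : Measure ℝ).real (Iio x) ≤ a) (h₂ : a ≤ (μ₀ : Measure ℝ).real (Iic x))
    (ha : a < (μ₀ : Measure ℝ).real univ) (t : ℝ) :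
    v t (x + u₀ x * t + t ^ 2 / 4 * a) = u₀ x + t / 2 * a := by
  obtain ⟨b₀, hab₀, hb₀⟩ := exists_between ha
  have hne : ∃ z, b₀ ≤ (μ₀ : Measure ℝ).real (Iic z) :=
    ((tendsto_real_Iic_atTop (μ₀ : Measure ℝ)).eventually (lt_mem_nhds hb₀)).exists.imp
      fun _ h => le_of_lt h
  set Y := x + u₀ x * t + t ^ 2 / 4 * a with hY
  set c := v t Y - (u₀ x + t / 2 * a) with hc
  -- A bound for the initial distance that is uniform in `b < b₀`.
  set X := quantile μ₀ b₀ - x with hX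
  have key : ∀ b ∈ Ioo a b₀, c ^ 2 ≤
      3 * (2 * (X + (b - a) * t ^ 2 / 4) * (b - a) + (t / 2 * (b - a)) ^ 2 + X * (b - a)) := by
    rintro b ⟨hab, hbb⟩
    have hneb : ∃ z, b ≤ (μ₀ : Measure ℝ).real (Iic z) := hne.imp fun _ h => hbb.le.trans h
    have hb : 0 < b := (measureReal_nonneg.trans h₁).trans_lt hab
    obtain ⟨g1, g2, g3, g4⟩ := hv.parabola_le_quantile h₁ h₂ hab hneb t
    obtain ⟨-, e2⟩ := hv.quantile_eq hb hneb t
    have hqX : quantile μ₀ b - x ≤ X :=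
      sub_le_sub_right (quantile_le hb (hbb.le.trans (le_real_Iic_quantile hne))) _
    have hB : 0 ≤ b - a := (sub_pos.2 hab).le
    have k1 : (v t (quantile (ν t) b) - v t Y) ^ 2 ≤ 2 * (X + (b - a) * t ^ 2 / 4) * (b - a) := by
      refine (hv.sq_sub_le_real_Iio t g3).trans ?_
      have l1 : (ν t : Measure ℝ).real (Iio (quantile (ν t) b)) ≤ b := real_Iio_quantile_le hb
      have l2 := hv.le_real_Iic_parabola h₁ h₂ t
      refine (mul_le_mul_of_nonneg_left (show _ ≤ b - a by linarith) (sub_nonneg.2 g3)).trans ?_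
      refine mul_le_mul_of_nonneg_right (g4.trans ?_) hB
      linarith
    have k2 : (u₀ (quantile μ₀ b) - u₀ x) ^ 2 ≤ X * (b - a) :=
      g2.trans (mul_le_mul_of_nonneg_right hqX hB)
    have k3 : c = -(v t (quantile (ν t) b) - v t Y) + t / 2 * (b - a) +
        (u₀ (quantile μ₀ b) - u₀ x) := by
      rw [hc, e2]
      ring
    rw [k3]
    have k4 := sq_neg_add_add_le (v t (quantile (ν t) b) - v t Y) (t / 2 * (b - a))
      (u₀ (quantile μ₀ b) - u₀ x)
    linarith
  have hcont : Continuous fun b =>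
      3 * (2 * (X + (b - a) * t ^ 2 / 4) * (b - a) + (t / 2 * (b - a)) ^ 2 + X * (b - a)) := by
    fun_prop
  have hlim := (hcont.tendsto a).mono_left (nhdsWithin_le_nhds (s := Ioi a))
  have h0 := ge_of_tendsto hlim (eventually_of_mem (Ioo_mem_nhdsGT hab₀) key)
  simp only [sub_self, zero_mul, mul_zero, zero_div, add_zero] at h0
  have h3 : c = 0 := pow_eq_zero_iff two_ne_zero |>.1 (le_antisymm (by simpa using h0) (sq_nonneg c))
  exact sub_eq_zero.1 h3

/-- At the top level no quantile lies to the right, so the left quantile is used, with no energy in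
between. If the total energy is zero, `v` is constant in space and the ODE is solved by integrating
in time. -/
theorem velocity_parabola (hv : IsConservativeSolution u₀ μ₀ v ν) {x a : ℝ}
    (h₁ : (μ₀ : Measure ℝ).real (Iio x) ≤ a) (h₂ : a ≤ (μ₀ : Measure ℝ).real (Iic x)) (t : ℝ) :
    v t (x + u₀ x * t + t ^ 2 / 4 * a) = u₀ x + t / 2 * a := by
  rcases lt_or_ge a ((μ₀ : Measure ℝ).real univ) with hM | hM
  · exact hv.velocity_parabola_of_lt h₁ h₂ hM t
  rcases (measureReal_nonneg.trans h₁).eq_or_lt with ha | ha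
  · have hz : ∀ s z, (ν s : Measure ℝ).real (Iic z) = 0 := fun s z => by
      refine le_antisymm ((measureReal_mono (subset_univ _)).trans ?_) measureReal_nonneg
      rw [hv.real_univ_eq s 0, hv.initial_μ]
      linarith
    have hconst : ∀ s p q, v s p = v s q := by
      have key : ∀ s p q, p ≤ q → v s q = v s p := fun s p q hpq =>
        hv.eq_of_energy_le (a := 0) hpq measureReal_nonneg
          (real_Iio_le_of_forall_lt _ fun z _ => (hz s z).le)
      intro s p q
      rcases le_total p q with h | h
      · exact (key s p q h).symm
      · exact key s q p h
    have hc : Continuous fun s => v s 0 :=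
      hv.continuous_uncurry.comp (continuous_id.prodMk continuous_const)
    set γ : ℝ → ℝ := fun r => x + ∫ s in (0 : ℝ)..r, v s 0 with hγ
    have hd : ∀ r, HasDerivAt γ (v r (γ r)) r := fun r => by
      rw [hconst r (γ r) 0]
      exact (intervalIntegral.integral_hasDerivAt_right (hc.intervalIntegrable _ _)
        (hc.stronglyMeasurableAtFilter _ _) hc.continuousAt).const_add _
    have h3 := hv.velocity_eq hd (ae_of_all _ fun s => hz s (γ s)) t
    have h4 : γ 0 = x := by simp [hγ]
    rw [h4, hv.initial_u] at h3
    rw [hconst t _ (γ t), h3, ← ha]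
  · obtain ⟨e1, hle, e2⟩ := hv.parabola_eq_quantile_add h₁ h₂ ha t
    have hne : ∃ z, a ≤ (ν 0 : Measure ℝ).real (Iic z) := ⟨x, by rwa [hv.initial_μ]⟩
    rw [← e2]
    exact hv.eq_of_energy_le (by rw [e1]; linarith)
      (le_real_Iic_quantile (hv.exists_le_real_Iic hne t)) (hv.real_Iio_parabola_le h₁ h₂ t)

end IsConservativeSolution

/-! ### The label map and the explicit solution -/

theorem xbar_mono (μ₀ : FiniteMeasure ℝ) : Monotone (xbar μ₀) := by
  intro α β h
  by_contra hcon
  have h1 := (xbar_spec μ₀ α).1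
  have h2 := (xbar_spec μ₀ β).2
  have h3 := real_Iic_le_real_Iio (μ₀ : Measure ℝ) (not_le.1 hcon)
  linarith

/-- Together with `xbar_mono` this makes `xbar` 1-Lipschitz. -/
theorem sub_xbar_mono (μ₀ : FiniteMeasure ℝ) : Monotone fun α => α - xbar μ₀ α := by
  intro α β h
  rcases (xbar_mono μ₀ h).eq_or_lt with h1 | h1
  · simp only [h1]
    linarith
  · have h2 := (xbar_spec μ₀ α).2
    have h3 := (xbar_spec μ₀ β).1
    have h4 := real_Iic_le_real_Iio (μ₀ : Measure ℝ) h1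
    simp only
    linarith

theorem lipschitzWith_xbar (μ₀ : FiniteMeasure ℝ) : LipschitzWith 1 (xbar μ₀) := by
  refine LipschitzWith.of_le_add fun α β => ?_
  rw [Real.dist_eq]
  rcases le_total α β with h | h
  · linarith [xbar_mono μ₀ h, abs_nonneg (α - β)]
  · have := sub_xbar_mono μ₀ h
    simp only at this
    linarith [le_abs_self (α - β)]

theorem sub_xbar_nonneg (μ₀ : FiniteMeasure ℝ) (α : ℝ) : 0 ≤ α - xbar μ₀ α := by
  have h1 := (xbar_spec μ₀ α).1
  have h2 : 0 ≤ (μ₀ : Measure ℝ).real (Iio (xbar μ₀ α)) := measureReal_nonneg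
  linarith

theorem sub_xbar_le (μ₀ : FiniteMeasure ℝ) (α : ℝ) :
    α - xbar μ₀ α ≤ (μ₀ : Measure ℝ).real univ := by
  have h1 := (xbar_spec μ₀ α).2
  have h2 : (μ₀ : Measure ℝ).real (Iic (xbar μ₀ α)) ≤ _ := measureReal_mono (subset_univ _)
  linarith

theorem tendsto_sub_xbar_atBot (μ₀ : FiniteMeasure ℝ) :
    Tendsto (fun α => α - xbar μ₀ α) atBot (𝓝 0) := by
  refine tendsto_of_tendsto_of_tendsto_of_le_of_le tendsto_const_nhds
    (tendsto_real_Iic_atBot (μ₀ : Measure ℝ)) (sub_xbar_nonneg μ₀) fun α => ?_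
  have h1 := (xbar_spec μ₀ α).2
  have h2 := real_Iic_mono (μ₀ : Measure ℝ) (sub_nonneg.1 (sub_xbar_nonneg μ₀ α))
  simp only
  linarith

/-- The fundamental theorem of calculus for the Lipschitz map `xbar`, with lower limit sent to `-∞`,
where `α - xbar μ₀ α` vanishes. -/
theorem withDensity_Iic_eq (μ₀ : FiniteMeasure ℝ) (A : ℝ) :
    volume.withDensity (fun α => ENNReal.ofReal (1 - deriv (xbar μ₀) α)) (Iic A) =
      ENNReal.ofReal (A - xbar μ₀ A) := by
  set m := volume.withDensity (fun α => ENNReal.ofReal (1 - deriv (xbar μ₀) α)) with hm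
  have hac : ∀ b c, AbsolutelyContinuousOnInterval (xbar μ₀) b c := fun b c =>
    (lipschitzWith_xbar μ₀).lipschitzOnWith.absolutelyContinuousOnInterval
  have h1 : ∀ b ≤ A, m (Ioc b A) = ENNReal.ofReal ((A - xbar μ₀ A) - (b - xbar μ₀ b)) := by
    intro b hb
    have hi : IntervalIntegrable (fun α => 1 - deriv (xbar μ₀) α) volume b A :=
      intervalIntegrable_const.sub (hac b A).intervalIntegrable_deriv
    have h2 : ∫ α in b..A, (1 - deriv (xbar μ₀) α) = (A - xbar μ₀ A) - (b - xbar μ₀ b) := by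
      rw [intervalIntegral.integral_sub intervalIntegrable_const (hac b A).intervalIntegrable_deriv,
        (hac b A).integral_deriv_eq_sub, intervalIntegral.integral_const, smul_eq_mul]
      ring
    rw [hm, withDensity_apply _ measurableSet_Ioc, ← h2, intervalIntegral.integral_of_le hb,
      ofReal_integral_eq_lintegral_ofReal ((intervalIntegrable_iff_integrableOn_Ioc_of_le hb).1 hi)]
    -- Lipschitz constant `1` makes the density nonnegative, so `ENNReal.ofReal` truncates nothing.
    refine ae_of_all _ fun α => sub_nonneg.2 ?_
    have := norm_deriv_le_of_lipschitz (lipschitzWith_xbar μ₀) (x₀ := α)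
    exact (le_abs_self _).trans (by simpa using this)
  have h2 : Tendsto (fun b => m (Ioc b A)) atBot (𝓝 (m (Iic A))) := tendsto_measure_Ioc_atBot m A
  have h3 : Tendsto (fun b => ENNReal.ofReal ((A - xbar μ₀ A) - (b - xbar μ₀ b))) atBot
      (𝓝 (ENNReal.ofReal ((A - xbar μ₀ A) - 0))) :=
    ENNReal.tendsto_ofReal (tendsto_const_nhds.sub (tendsto_sub_xbar_atBot μ₀))
  rw [sub_zero] at h3
  exact tendsto_nhds_unique (h2.congr' ((eventually_le_atBot A).mono h1)) h3

theorem continuous_yMap (u₀ : ℝ →ᵇ ℝ) (μ₀ : FiniteMeasure ℝ) (t : ℝ) :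
    Continuous fun α => yMap u₀ μ₀ α t := by
  have h := (lipschitzWith_xbar μ₀).continuous
  exact (h.add ((u₀.continuous.comp h).mul continuous_const)).add
    (continuous_const.mul (continuous_id.sub h))

/-- Bounded distance from the identity gives surjectivity and bounds the label sets used below. -/
theorem exists_abs_yMap_sub_le (u₀ : ℝ →ᵇ ℝ) (μ₀ : FiniteMeasure ℝ) (t : ℝ) :
    ∃ C, ∀ α, |yMap u₀ μ₀ α t - α| ≤ C := by
  set M := (μ₀ : Measure ℝ).real univ
  refine ⟨M + ‖u₀‖ * |t| + t ^ 2 / 4 * M, fun α => ?_⟩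
  have h1 := sub_xbar_nonneg μ₀ α
  have h2 := sub_xbar_le μ₀ α
  have h3 : |u₀ (xbar μ₀ α) * t| ≤ ‖u₀‖ * |t| := by
    rw [abs_mul]
    exact mul_le_mul_of_nonneg_right (u₀.norm_coe_le_norm _) (abs_nonneg _)
  have h4 : t ^ 2 / 4 * (α - xbar μ₀ α) ≤ t ^ 2 / 4 * M :=
    mul_le_mul_of_nonneg_left h2 (by positivity)
  have h5 : 0 ≤ t ^ 2 / 4 * (α - xbar μ₀ α) := mul_nonneg (by positivity) h1
  obtain ⟨h6, h7⟩ := abs_le.1 h3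
  have h8 : 0 ≤ M := measureReal_nonneg
  rw [abs_le]
  simp only [yMap]
  constructor <;> linarith

theorem surjective_yMap (u₀ : ℝ →ᵇ ℝ) (μ₀ : FiniteMeasure ℝ) (t : ℝ) :
    Function.Surjective fun α => yMap u₀ μ₀ α t := by
  obtain ⟨C, hC⟩ := exists_abs_yMap_sub_le u₀ μ₀ t
  refine (continuous_yMap u₀ μ₀ t).surjective
    (tendsto_atTop_mono (fun α => ?_) (tendsto_atTop_add_const_right _ (-C) tendsto_id))
    (tendsto_atBot_mono (fun α => ?_) (tendsto_atBot_add_const_right _ C tendsto_id))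
  · have := (abs_le.1 (hC α)).1
    simp only [id]
    linarith
  · have := (abs_le.1 (hC α)).2
    simp only [id]
    linarith

theorem yMap_sInf (u₀ : ℝ →ᵇ ℝ) (μ₀ : FiniteMeasure ℝ) (t x : ℝ) :
    yMap u₀ μ₀ (sInf {α | yMap u₀ μ₀ α t = x}) t = x := by
  obtain ⟨C, hC⟩ := exists_abs_yMap_sub_le u₀ μ₀ t
  refine (isClosed_eq (continuous_yMap u₀ μ₀ t) continuous_const).csInf_mem
    (surjective_yMap u₀ μ₀ t x) ⟨x - C, fun α hα => ?_⟩
  have h1 : yMap u₀ μ₀ α t = x := hα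
  have h2 := (abs_le.1 (hC α)).2
  linarith

/-! ### Identification of a given solution with the explicit one -/

namespace IsConservativeSolution

variable {u₀ : ℝ →ᵇ ℝ} {μ₀ : FiniteMeasure ℝ} {v : ℝ → (ℝ →ᵇ ℝ)} {ν : ℝ → FiniteMeasure ℝ}

theorem energy_yMap (hv : IsConservativeSolution u₀ μ₀ v ν) (α t : ℝ) :
    (ν t : Measure ℝ).real (Iio (yMap u₀ μ₀ α t)) ≤ α - xbar μ₀ α ∧
      α - xbar μ₀ α ≤ (ν t : Measure ℝ).real (Iic (yMap u₀ μ₀ α t)) := by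
  obtain ⟨k1, k2⟩ := xbar_spec μ₀ α
  exact ⟨hv.real_Iio_parabola_le (by linarith) (by linarith) t,
    hv.le_real_Iic_parabola (by linarith) (by linarith) t⟩

theorem velocity_yMap (hv : IsConservativeSolution u₀ μ₀ v ν) (α t : ℝ) :
    v t (yMap u₀ μ₀ α t) = yVel u₀ μ₀ α t := by
  obtain ⟨k1, k2⟩ := xbar_spec μ₀ α
  exact hv.velocity_parabola (by linarith) (by linarith) t

theorem isCharacteristic_yMap (hv : IsConservativeSolution u₀ μ₀ v ν) (α : ℝ) :
    IsCharacteristic μ₀ v ν α (yMap u₀ μ₀ α) :=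
  ⟨fun t => (hasDerivAt_yMap u₀ μ₀ α t).congr_deriv (hv.velocity_yMap α t).symm, by simp [yMap],
    ae_of_all _ (hv.energy_yMap α)⟩

theorem eq_yMap (hv : IsConservativeSolution u₀ μ₀ v ν) {α : ℝ} {γ : ℝ → ℝ}
    (hγ : IsCharacteristic μ₀ v ν α γ) : γ = yMap u₀ μ₀ α := by
  funext t
  rw [hv.characteristic_eq hγ.hasDerivAt hγ.energy t, hγ.initial, yMap]

/-- Labels with the same energy level have equal `u₀`, hence translated parabolas; for different
levels a crossing would contradict the energy bounds at time `t`. -/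
theorem monotone_yMap (hv : IsConservativeSolution u₀ μ₀ v ν) (t : ℝ) :
    Monotone fun α => yMap u₀ μ₀ α t := by
  intro α β h
  rcases (sub_xbar_mono μ₀ h).eq_or_lt with h1 | h1
  · have hx := xbar_mono μ₀ h
    have hu : u₀ (xbar μ₀ β) = u₀ (xbar μ₀ α) := by
      have := hv.eq_of_energy_le (t := 0) (a := α - xbar μ₀ α) hx
      rw [hv.initial_u, hv.initial_μ] at this
      simp only at h1
      exact this (by linarith [(xbar_spec μ₀ α).2]) (by linarith [(xbar_spec μ₀ β).1])
    simp only [yMap] at h1 ⊢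
    rw [h1, hu]
    linarith
  · by_contra hcon
    have h2 := real_Iic_le_real_Iio (ν t : Measure ℝ) (not_le.1 hcon)
    have h3 := (hv.energy_yMap α t).1
    have h4 := (hv.energy_yMap β t).2
    simp only at h1 h2
    linarith

/-- By monotonicity the labels carried into `Iic x` form `Iic A`, with `A` the largest label over
`x`, so both measures should give `Iic x` the mass `A - xbar μ₀ A`. -/
theorem eq_explicitMu (hv : IsConservativeSolution u₀ μ₀ v ν) (t : ℝ) :
    (ν t : Measure ℝ) = explicitMu u₀ μ₀ t := by
  refine Measure.ext_of_Iic _ _ fun x => ?_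
  have hc := continuous_yMap u₀ μ₀ t
  obtain ⟨C, hC⟩ := exists_abs_yMap_sub_le u₀ μ₀ t
  set S : Set ℝ := {α | yMap u₀ μ₀ α t ≤ x} with hS
  obtain ⟨α₀, hα₀⟩ := surjective_yMap u₀ μ₀ t x
  have hα₀S : α₀ ∈ S := le_of_eq hα₀
  have hbdd : BddAbove S := ⟨x + C, fun α hα => by
    have h1 : yMap u₀ μ₀ α t ≤ x := hα
    linarith [(abs_le.1 (hC α)).1]⟩
  set A := sSup S with hA
  have hAS : A ∈ S := (isClosed_le hc continuous_const).csSup_mem ⟨α₀, hα₀S⟩ hbdd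
  have hSA : S = Iic A := by
    ext α
    exact ⟨fun h => le_csSup hbdd h, fun h => (hv.monotone_yMap t h).trans hAS⟩
  have hyA : yMap u₀ μ₀ A t = x :=
    le_antisymm hAS (hα₀.symm.le.trans (hv.monotone_yMap t (le_csSup hbdd hα₀S)))
  have hle : A - xbar μ₀ A ≤ (ν t : Measure ℝ).real (Iic x) := by
    have := (hv.energy_yMap A t).2
    rwa [hyA] at this
  -- Labels `β > A` lie strictly right of `x`, so their energy bound controls the closed half-line;
  -- then `β` decreases to `A`. The bound at `A` itself would miss an atom at `x`.
  have hge : (ν t : Measure ℝ).real (Iic x) ≤ A - xbar μ₀ A := by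
    have hcont : Continuous fun α => α - xbar μ₀ α :=
      continuous_id.sub (lipschitzWith_xbar μ₀).continuous
    refine ge_of_tendsto ((hcont.tendsto A).mono_left (nhdsWithin_le_nhds (s := Ioi A))) ?_
    filter_upwards [self_mem_nhdsWithin] with β (hβ : A < β)
    have h1 : x < yMap u₀ μ₀ β t := by
      by_contra hcon
      exact absurd (le_csSup hbdd (show β ∈ S from not_lt.1 hcon)) (not_le.2 hβ)
    exact (real_Iic_le_real_Iio _ h1).trans (hv.energy_yMap β t).1
  rw [explicitMu, Measure.map_apply hc.measurable measurableSet_Iic]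
  change _ = volume.withDensity (fun α => ENNReal.ofReal (1 - deriv (xbar μ₀) α)) S
  rw [hSA, withDensity_Iic_eq, ← le_antisymm hge hle, ofReal_measureReal]

end IsConservativeSolution

end HunterSaxton

end

theorem theorem3p2
    (u₀ : BoundedContinuousFunction ℝ ℝ) (μ₀ : MeasureTheory.FiniteMeasure ℝ)
    (hD : HunterSaxton.MemD u₀ μ₀)
    (v : ℝ → BoundedContinuousFunction ℝ ℝ) (ν : ℝ → MeasureTheory.FiniteMeasure ℝ)
    (hv : HunterSaxton.IsConservativeSolution u₀ μ₀ v ν) :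
    -- existence and uniqueness of the characteristic, for every label `α`
    (∀ α : ℝ, ∃! γ : ℝ → ℝ, HunterSaxton.IsCharacteristic μ₀ v ν α γ) ∧
    -- the characteristic is `t ↦ y(α, t)`
    (∀ α : ℝ, ∀ γ : ℝ → ℝ, HunterSaxton.IsCharacteristic μ₀ v ν α γ →
      ∀ t, γ t = HunterSaxton.yMap u₀ μ₀ α t) ∧
    -- `v(x, t) = ∂_t y(α, t)` whenever `x = y(α, t)`, and every `x` is of this form
    (∀ t x : ℝ, ∃ α : ℝ, HunterSaxton.yMap u₀ μ₀ α t = x) ∧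
    (∀ t α : ℝ, v t (HunterSaxton.yMap u₀ μ₀ α t) = HunterSaxton.yVel u₀ μ₀ α t) ∧
    -- `(v, ν) = (u, μ)`
    (∀ t x : ℝ, v t x = HunterSaxton.explicitU u₀ μ₀ t x) ∧
    (∀ t : ℝ, (ν t : MeasureTheory.Measure ℝ) = HunterSaxton.explicitMu u₀ μ₀ t) := by
  refine ⟨fun α => ⟨HunterSaxton.yMap u₀ μ₀ α, hv.isCharacteristic_yMap α,
      fun γ hγ => hv.eq_yMap hγ⟩, fun α γ hγ t => by rw [hv.eq_yMap hγ],
    HunterSaxton.surjective_yMap u₀ μ₀, fun t α => hv.velocity_yMap α t, fun t x => ?_,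
    hv.eq_explicitMu⟩
  -- The infimum label chosen in `explicitU` is attained, so it lies over `x`.
  rw [HunterSaxton.explicitU, ← hv.velocity_yMap, HunterSaxton.yMap_sInf]
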